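/- Let $S^2\subset\mathbb R^3$ be the unit sphere with the round metric $\bar g$ (of constant curvature $1$), let $\bar\mu$ be the area form of $\bar g$ for a given orientation of $S^2$, let $\pi:T^*S^2\to S^2$ be the projection, $|p|$ the dual norm of a covector $p$ with respect to $\bar g$, and $\lambda$ the Liouville form on $T^*S^2$, $\lambda_{(q,p)}(\xi)=p(d\pi\,\xi)$. There exists a family of symplectomorphisms $$\Psi_s:\big(\{|p|>s\},\,d\lambda\big)\longrightarrow\big(\{|p|>0\},\,d\lambda-s\,\pi^*\bar\mu\big),\qquad s\in[0,+\infty),$$ with $\Psi_s(q,p)$ depending smoothly on $(s,q,p)$ for $s\ge 0$, $|p|>s$, such that: 1. $\Psi_s\circ\hat F=\hat F\circ\Psi_s$ on $\{|p|>s\}$ for every $s\ge 0$ and every orientation-preserving isometry $F$ of $(S^2,\bar g)$, where $\hat F(q,p)=\big(F(q),\,p\circ(d_qF)^{-1}\big)$; 2. $\Psi_0$ is the identity of $\{|p|>0\}$; 3. for every $s>0$, $\Psi_s$ admits a continuous extension $\{|p|\ge s\}\to T^*S^2$ which sends $\{|p|=s\}$ onto the zero section $\{|p|=0\}$. -/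

import Mathlib

open scoped Manifold ContDiff InnerProductSpace

noncomputable section

namespace MagneticSphere

section Forms

variable {E : Type*} [NormedAddCommGroup E] [NormedSpace ℝ E]
  {H : Type*} [TopologicalSpace H] (I : ModelWithCorners ℝ E H)
  {M : Type*} [TopologicalSpace M] [ChartedSpace H M]

/-- A (not necessarily smooth) differential `k`-form on the manifold `M`. -/
abbrev DiffForm (k : ℕ) : Type _ :=
  (x : M) → TangentSpace I x [⋀^Fin k]→L[ℝ] ℝ

variable {I}

/-- The expression of a differential form in the preferred chart `φ` at `x₀`: the form
`(φ⁻¹)^* α` on the model vector space `E` (meaningful on the range of the chart). -/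
def DiffForm.inChart {k : ℕ} (α : DiffForm I (M := M) k) (x₀ : M) :
    E → E [⋀^Fin k]→L[ℝ] ℝ :=
  fun y => (α ((extChartAt I x₀).symm y)).compContinuousLinearMap
    (mfderiv 𝓘(ℝ, E) I (extChartAt I x₀).symm y)

/-- The exterior derivative `dα` on a manifold without boundary. At `x` it is
`φ^* d((φ⁻¹)^* α)`, where `φ` is the preferred chart at `x`. -/
def DiffForm.d {k : ℕ} (α : DiffForm I (M := M) k) : DiffForm I (M := M) (k + 1) :=
  fun x => (extDeriv (α.inChart x) (extChartAt I x x)).compContinuousLinearMap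
    (mfderiv I 𝓘(ℝ, E) (extChartAt I x) x)

/-- The pull-back `f^* β` of a differential form, pointwise `β (f x) (df ·, …, df ·)`. -/
def DiffForm.pullback {E' : Type*} [NormedAddCommGroup E'] [NormedSpace ℝ E']
    {H' : Type*} [TopologicalSpace H'] {J : ModelWithCorners ℝ E' H'}
    {N : Type*} [TopologicalSpace N] [ChartedSpace H' N] {k : ℕ}
    (f : M → N) (β : DiffForm J (M := N) k) : DiffForm I (M := M) k :=
  fun x => (β (f x)).compContinuousLinearMap (mfderiv I J f x)

/-- `f` restricts to a symplectomorphism `(U, ω₁) → (V, ω₂)` between the open subsets `U` and `V`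
of `M`: a smooth bijection `U → V` with smooth inverse such that `f^* ω₂ = ω₁` on `U`. -/
structure IsSymplectomorphismOn (ω₁ ω₂ : DiffForm I (M := M) 2) (U V : Set M) (f : M → M) :
    Prop where
  isOpen_source : IsOpen U
  isOpen_target : IsOpen V
  smooth : ContMDiffOn I I ∞ f U
  bijOn : Set.BijOn f U V
  smooth_inverse : ∃ g : M → M, Set.InvOn g f U V ∧ ContMDiffOn I I ∞ g V
  pullback_eq : ∀ x ∈ U, DiffForm.pullback (I := I) f ω₂ x = ω₁ x

end Forms

/-- Euclidean three-space. -/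
abbrev E3 : Type := EuclideanSpace ℝ (Fin 3)

/-- The unit sphere of `E3`, with Mathlib's smooth structure (model `𝓡 2`). -/
abbrev S2 : Type := Metric.sphere (0 : E3) 1

/-- The differential at `q` of the inclusion of the sphere in `E3`. It identifies the tangent
space `T_q S²` with the plane orthogonal to `q`. -/
def dIncl (q : S2) : TangentSpace (𝓡 2) q →L[ℝ] E3 :=
  mvfderiv (𝓡 2) (Subtype.val : S2 → E3) q

/-- The round metric (of constant curvature `1`), induced by the inclusion in `E3`. -/
def roundMetric (q : S2) (u v : TangentSpace (𝓡 2) q) : ℝ :=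
  ⟪dIncl q u, dIncl q v⟫_ℝ

/-- The volume form of an orientation of `E3`, as a continuous alternating map. -/
def volE3 (o : Orientation ℝ E3 (Fin 3)) : E3 [⋀^Fin 3]→L[ℝ] ℝ :=
  haveI : Fact (Module.finrank ℝ E3 = 3) := ⟨finrank_euclideanSpace_fin⟩
  o.volumeForm.mkContinuous 1 (fun v => by
    simpa using o.abs_volumeForm_apply_le v)

/-- The area form of the round metric and of an orientation of `S²`. The two orientations of `S²`
correspond to those of `E3`: a basis `(u, v)` of `T_q S²` is positive when `(q, u, v)` is. -/
def areaForm (o : Orientation ℝ E3 (Fin 3)) : DiffForm (𝓡 2) (M := S2) 2 :=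
  fun q => ((volE3 o).curryLeft (q : E3)).compContinuousLinearMap (dIncl q)

/-- The cotangent bundle of the sphere: its points are pairs `(q, p)` with `p` a linear form
on `T_q S²`. -/
abbrev CotangentS2 : Type :=
  Bundle.TotalSpace (EuclideanSpace ℝ (Fin 2) →L[ℝ] ℝ)
    (fun q : S2 => TangentSpace (𝓡 2) q →L[ℝ] ℝ)

/-- The model with corners of the four-manifold `T^*S²`. -/
abbrev ICot : ModelWithCorners ℝ
    (EuclideanSpace ℝ (Fin 2) × (EuclideanSpace ℝ (Fin 2) →L[ℝ] ℝ))
    (ModelProd (EuclideanSpace ℝ (Fin 2)) (EuclideanSpace ℝ (Fin 2) →L[ℝ] ℝ)) :=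
  (𝓡 2).prod 𝓘(ℝ, EuclideanSpace ℝ (Fin 2) →L[ℝ] ℝ)

/-- The foot-point projection `π : T^*S² → S²`. -/
def footPoint (x : CotangentS2) : S2 := x.proj

/-- The dual norm `|p|` of a covector with respect to the round metric: the least `c ≥ 0` such
that `|p(u)| ≤ c |u|` for all tangent vectors `u`. -/
def conorm (x : CotangentS2) : ℝ :=
  sInf {c : ℝ | 0 ≤ c ∧ ∀ u : TangentSpace (𝓡 2) x.proj,
    |x.2 u| ≤ c * Real.sqrt (roundMetric x.proj u u)}

/-- The Liouville (tautological) one-form `λ_{(q,p)}(ξ) = p(dπ ξ)` on `T^*S²`. -/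
def liouville : DiffForm ICot (M := CotangentS2) 1 :=
  fun x => ContinuousAlternatingMap.ofSubsingleton ℝ (TangentSpace ICot x) ℝ (0 : Fin 1)
    (x.2 ∘L (mfderiv ICot (𝓡 2) footPoint x))

/-- The twisted symplectic form `dλ - s π^* μ` on `T^*S²`, where `μ` is the round area form. -/
def twistedForm (o : Orientation ℝ E3 (Fin 3)) (s : ℝ) : DiffForm ICot (M := CotangentS2) 2 :=
  fun x => liouville.d x - s • DiffForm.pullback (I := ICot) footPoint (areaForm o) x

/-- A diffeomorphism of `S²` is an orientation-preserving isometry of the round metric if its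
differential preserves the metric and the area form. (For a map preserving the metric, the latter
says that it preserves the orientation; this does not depend on the choice of `o`.) -/
structure IsOrientedIsometry (o : Orientation ℝ E3 (Fin 3)) (F : S2 ≃ₘ⟮𝓡 2, 𝓡 2⟯ S2) : Prop where
  metric : ∀ (q : S2) (u v : TangentSpace (𝓡 2) q),
    roundMetric (F q) (mfderiv (𝓡 2) (𝓡 2) F q u) (mfderiv (𝓡 2) (𝓡 2) F q v) = roundMetric q u v
  area : DiffForm.pullback (I := 𝓡 2) F (areaForm o) = areaForm o

/-- The map induced by a diffeomorphism on `T^*S²`, `(q, p) ↦ (F q, p ∘ (d_q F)⁻¹)`. -/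
def cotangentLift (F : S2 ≃ₘ⟮𝓡 2, 𝓡 2⟯ S2) (x : CotangentS2) : CotangentS2 :=
  ⟨F x.proj, x.2 ∘L
    (F.mfderivToContinuousLinearEquiv (by simp) x.proj).symm.toContinuousLinearMap⟩

end MagneticSphere

end

/-! Identify `T^*S²` with the pairs (q, v) in E3 × E3 such that |q| = 1 and v ⊥ q. On tangent
vectors (a, b), (a', b') the form dλ becomes ⟪b, a'⟫ - ⟪b', a⟫, and the magnetic term becomes s
vol(q, a, a') (`twistedForm_apply`).

Up to a common sign, rotations have momentum q × v for dλ and q × v + s q for the twisted form. The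
latter has squared norm |v|² + s², so a map matching the two momenta must replace |v| by √(|v|² -
s²). Keep the direction of v and turn q in the plane orthogonal to v: Q = c q + k q × v, V = c v,
with c = √(|v|² - s²)/|v| and k = s/|v|². Since c² + k²|v|² = 1 and k|v|² = s, indeed Q × V + s Q =
q × v.

That this map pulls the twisted form back to dλ is checked directly in the orthogonal frame (q, v, q
× v) (`twist_identity`); its inverse is explicit (`untwist`). The formula uses only norms and the
cross product. It therefore commutes with rotations, and an oriented Riemannian isometry of the
sphere is the restriction of one (`IsOrientedIsometry.exists_linear`,
`IsOrientedIsometry.cross_eq`). For s = 0 one has c = 1, k = 0. On |v| = s > 0 one has c = 0: the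
formula stays continuous and sends (q, v) to (q × v / s, 0). -/

noncomputable section

namespace MagneticSphere

/-! ### The sphere and its tangent planes in Euclidean space -/

section Embedding

section Sphere

variable {E : Type*} [NormedAddCommGroup E] [NormedSpace ℝ E]
  {H : Type*} [TopologicalSpace H] {I : ModelWithCorners ℝ E H}
  {M : Type*} [TopologicalSpace M] [ChartedSpace H M]

/-- The sphere is an embedded submanifold: a map to it is smooth if it is smooth as a map to the
ambient space. -/
theorem contMDiffWithinAt_of_coe_S2 {f : M → S2} {s : Set M} {x : M} {m : WithTop ℕ∞}
    (hf : ContMDiffWithinAt I 𝓘(ℝ, E3) m (fun y => (f y : E3)) s x) :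
    ContMDiffWithinAt I (𝓡 2) m f s x := by
  rw [contMDiffWithinAt_iff_target]
  refine ⟨?_, ?_⟩
  · have := hf.continuousWithinAt
    exact Topology.IsInducing.subtypeVal.continuousWithinAt_iff.2 this
  · have : Fact (Module.finrank ℝ E3 = 2 + 1) := ⟨finrank_euclideanSpace_fin⟩
    -- The preferred chart at `f x` is the stereographic projection from the antipode `-f x`; its
    -- formula is smooth on an open subset of E3 containing `f x`.
    let U := (OrthonormalBasis.fromOrthogonalSpanSingleton (𝕜 := ℝ) 2
        (ne_zero_of_mem_unit_sphere (-(f x)))).repr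
    have h1 : ContDiffAt ℝ m (fun y : E3 => U (stereoToFun ((-(f x) : S2) : E3) y)) (f x : E3) := by
      refine U.contDiff.contDiffAt.comp _ ?_
      refine (contDiffOn_stereoToFun (n := m)).contDiffAt ?_
      refine IsOpen.mem_nhds ?_ ?_
      · exact isOpen_ne_fun (by fun_prop) (by fun_prop)
      · simp
        norm_num
    exact h1.contMDiffAt.comp_contMDiffWithinAt (f := fun y => (f y : E3)) x hf

end Sphere

/-- A point of the sphere. -/
def basePoint : S2 := ⟨EuclideanSpace.single 0 1, by simp⟩

open Classical in
/-- The radial projection `E3 \ {0} → S²`. -/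
def normalize (a : E3) : S2 :=
  if h : a = 0 then basePoint else ⟨‖a‖⁻¹ • a, by simp [norm_smul, h]⟩

theorem coe_normalize {a : E3} (h : a ≠ 0) : (normalize a : E3) = ‖a‖⁻¹ • a := by
  simp [normalize, h]

theorem norm_coe_S2 (q : S2) : ‖(q : E3)‖ = 1 := by simp

theorem inner_self_S2 (q : S2) : ⟪(q : E3), (q : E3)⟫_ℝ = 1 := by simp

theorem coe_S2_ne_zero (q : S2) : (q : E3) ≠ 0 := by
  intro h; have := norm_coe_S2 q; simp [h] at this

theorem normalize_of_norm_eq_one {a : E3} (h : ‖a‖ = 1) : (normalize a : E3) = a := by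
  have : a ≠ 0 := by rintro rfl; simp at h
  simp [coe_normalize this, h]

@[simp] theorem normalize_coe (q : S2) : normalize (q : E3) = q :=
  Subtype.ext (normalize_of_norm_eq_one (norm_coe_S2 q))

theorem contDiffAt_coe_normalize {a : E3} (h : a ≠ 0) {m : WithTop ℕ∞} :
    ContDiffAt ℝ m (fun b => (normalize b : E3)) a := by
  have h1 : ContDiffAt ℝ m (fun b : E3 => ‖b‖⁻¹ • b) a :=
    ((contDiffAt_norm ℝ h).inv (by simpa using h)).smul contDiffAt_id
  refine h1.congr_of_eventuallyEq ?_
  filter_upwards [isOpen_ne.mem_nhds h] with b hb using coe_normalize hb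

theorem contMDiffAt_normalize {a : E3} (h : a ≠ 0) {m : WithTop ℕ∞} :
    ContMDiffAt 𝓘(ℝ, E3) (𝓡 2) m normalize a :=
  contMDiffWithinAt_of_coe_S2 (contDiffAt_coe_normalize h).contMDiffAt

theorem contMDiff_coe_S2 {m : WithTop ℕ∞} :
    ContMDiff (𝓡 2) 𝓘(ℝ, E3) m (Subtype.val : S2 → E3) :=
  have : Fact (Module.finrank ℝ E3 = 2 + 1) := ⟨finrank_euclideanSpace_fin⟩
  contMDiff_coe_sphere

theorem mdifferentiableAt_coe_S2 (q : S2) :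
    MDifferentiableAt (𝓡 2) 𝓘(ℝ, E3) (Subtype.val : S2 → E3) q :=
  (contMDiff_coe_S2 (m := ∞)).mdifferentiableAt (by simp)

theorem injective_dIncl (q : S2) : Function.Injective (dIncl q) :=
  have : Fact (Module.finrank ℝ E3 = 2 + 1) := ⟨finrank_euclideanSpace_fin⟩
  injective_mvfderiv_subtypeVal_sphere q

theorem inner_dIncl (q : S2) (u : TangentSpace (𝓡 2) q) : ⟪(q : E3), dIncl q u⟫_ℝ = 0 := by
  have : Fact (Module.finrank ℝ E3 = 2 + 1) := ⟨finrank_euclideanSpace_fin⟩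
  have h := range_mvfderiv_subtypeVal (E := E3) (n := 2) q
  have : dIncl q u ∈ (ℝ ∙ (q : E3))ᗮ := by
    rw [← h]; exact ⟨u, rfl⟩
  exact Submodule.mem_orthogonal_singleton_iff_inner_right.1 this

theorem hasFDerivAt_coe_normalize (q : S2) :
    HasFDerivAt (fun b => (normalize b : E3))
      (ContinuousLinearMap.id ℝ E3 - (innerSL ℝ (q : E3)).smulRight (q : E3)) (q : E3) := by
  have hn := ((contDiffAt_norm ℝ (coe_S2_ne_zero q) (n := 1)).differentiableAt
    (by simp)).hasFDerivAt
  -- Obtained by differentiating ‖b‖² in two ways at a point of norm one.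
  have hL : fderiv ℝ (fun b : E3 => ‖b‖) (q : E3) = innerSL ℝ (q : E3) := by
    have h2 := (hasStrictFDerivAt_norm_sq (F := E3) (q : E3)).hasFDerivAt
    have h3 := h2.unique (hn.pow 2)
    ext a
    have h4 := congrArg (fun L => L a) h3
    simp at h4
    simpa using h4.symm
  rw [hL] at hn
  have h5 := ((hasDerivAt_inv (by simp)).comp_hasFDerivAt (q : E3) hn).fun_smul (hasFDerivAt_id (𝕜 := ℝ) (q : E3))
  refine (h5.congr_of_eventuallyEq (f₁ := fun b => (normalize b : E3)) ?_).congr_fderiv ?_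
  · filter_upwards [isOpen_ne.mem_nhds (coe_S2_ne_zero q)] with b hb using coe_normalize hb
  · ext a i
    simp
    ring

/-- Chain rule for the radial projection. -/
theorem dIncl_mfderiv_normalize (q : S2) (a : E3) :
    dIncl (normalize (q : E3)) (mfderiv 𝓘(ℝ, E3) (𝓡 2) normalize (q : E3) a)
      = a - ⟪(q : E3), a⟫_ℝ • (q : E3) := by
  have h1 := (mdifferentiableAt_coe_S2 (normalize (q : E3))).hasMFDerivAt.comp (q : E3)
    ((contMDiffAt_normalize (coe_S2_ne_zero q) (m := ∞)).mdifferentiableAt (by simp)).hasMFDerivAt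
  have h2 := hasMFDerivAt_unique h1 (hasFDerivAt_coe_normalize q).hasMFDerivAt
  have h3 := congrArg (fun L => L a) h2
  exact h3

/-- The differential of `normalize` at q is the wanted map, but it lands in the tangent space at
`normalize q`, equal to q only propositionally; hence the transport along q' = q. -/
theorem exists_tangentProj (q : S2) : ∃ X : E3 →L[ℝ] TangentSpace (𝓡 2) q,
    ∀ a, dIncl q (X a) = a - ⟪(q : E3), a⟫_ℝ • (q : E3) := by
  have h : ∀ q' : S2, q' = q → ∀ Y : E3 →L[ℝ] TangentSpace (𝓡 2) q',
      (∀ a, dIncl q' (Y a) = a - ⟪(q : E3), a⟫_ℝ • (q : E3)) →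
      ∃ X : E3 →L[ℝ] TangentSpace (𝓡 2) q,
        ∀ a, dIncl q (X a) = a - ⟪(q : E3), a⟫_ℝ • (q : E3) := by
    rintro _ rfl Y hY
    exact ⟨Y, hY⟩
  exact h _ (normalize_coe q) (mfderiv 𝓘(ℝ, E3) (𝓡 2) normalize (q : E3))
    (dIncl_mfderiv_normalize q)

/-- The orthogonal projection of a vector of `E3` to the tangent plane `T_q S²`. -/
def tangentProj (q : S2) : E3 →L[ℝ] TangentSpace (𝓡 2) q := (exists_tangentProj q).choose

theorem dIncl_tangentProj (q : S2) (a : E3) :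
    dIncl q (tangentProj q a) = a - ⟪(q : E3), a⟫_ℝ • (q : E3) :=
  (exists_tangentProj q).choose_spec a

theorem dIncl_tangentProj_of_inner_eq_zero {q : S2} {a : E3} (h : ⟪(q : E3), a⟫_ℝ = 0) :
    dIncl q (tangentProj q a) = a := by
  simp [dIncl_tangentProj, h]

@[simp] theorem tangentProj_dIncl (q : S2) (u : TangentSpace (𝓡 2) q) :
    tangentProj q (dIncl q u) = u :=
  injective_dIncl q (dIncl_tangentProj_of_inner_eq_zero (inner_dIncl q u))

@[simp] theorem tangentProj_self (q : S2) : tangentProj q (q : E3) = 0 :=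
  injective_dIncl q (by simp [dIncl_tangentProj])

/-- The vector field on the sphere obtained by projecting a constant field is smooth. -/
theorem contMDiff_tangentProj (a : E3) :
    ContMDiff (𝓡 2) (𝓡 2).tangent ∞
      (fun q : S2 => (⟨q, tangentProj q a⟩ : TangentBundle (𝓡 2) S2)) := by
  have hs : UniqueMDiffOn 𝓘(ℝ, E3) {b : E3 | b ≠ 0} := isOpen_ne.uniqueMDiffOn
  have h1 : ContMDiffOn 𝓘(ℝ, E3) (𝓡 2) ∞ normalize {b : E3 | b ≠ 0} :=
    fun b hb => (contMDiffAt_normalize hb).contMDiffWithinAt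
  -- The projected field is the tangent map of `normalize` applied to the smooth section (q, a).
  have h2 := h1.contMDiffOn_tangentMapWithin (m := ∞) (by simp) hs
  have h3 : ContMDiff (𝓡 2) 𝓘(ℝ, E3).tangent ∞
      (fun q : S2 => (⟨(q : E3), a⟩ : TangentBundle 𝓘(ℝ, E3) E3)) := by
    intro q
    rw [Bundle.contMDiffAt_totalSpace]
    refine ⟨contMDiff_coe_S2 q, ?_⟩
    simpa using contMDiffAt_const
  have h4 := h2.comp_contMDiff h3 (fun q => coe_S2_ne_zero q)
  refine h4.congr fun q => ?_
  have key : ∀ q' : S2, q = q' → ∀ w : TangentSpace (𝓡 2) q',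
      dIncl q' w = a - ⟪(q : E3), a⟫_ℝ • (q : E3) →
      (⟨q, tangentProj q a⟩ : TangentBundle (𝓡 2) S2) = ⟨q', w⟩ := by
    rintro _ rfl w hw
    congr 1
    exact injective_dIncl q (by rw [hw, dIncl_tangentProj])
  refine key _ (normalize_coe q).symm _ ?_
  rw [mfderivWithin_of_mem_nhds (isOpen_ne.mem_nhds (coe_S2_ne_zero q))]
  exact dIncl_mfderiv_normalize q a

/-! ### The cotangent bundle as a submanifold of `E3 × E3` -/

/-- The vector of `T_q S² ⊂ E3` dual to the covector `p`. -/
def covec (x : CotangentS2) : E3 :=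
  (InnerProductSpace.toDual ℝ E3).symm (x.2 ∘L tangentProj x.1)

theorem inner_covec (x : CotangentS2) (a : E3) : ⟪covec x, a⟫_ℝ = x.2 (tangentProj x.1 a) := by
  simp [covec]

theorem inner_covec_dIncl (x : CotangentS2) (u : TangentSpace (𝓡 2) x.1) :
    ⟪covec x, dIncl x.1 u⟫_ℝ = x.2 u := by
  simp [inner_covec]

theorem inner_coe_covec (x : CotangentS2) : ⟪(x.1 : E3), covec x⟫_ℝ = 0 := by
  rw [real_inner_comm, inner_covec]; simp

/-- Each coordinate of the dual vector is the pairing of p with the projection of a constant field,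
and such pairings are smooth on the bundle. -/
theorem contMDiff_covec : ContMDiff ICot 𝓘(ℝ, E3) ∞ covec := by
  have h (a : E3) : ContMDiff ICot 𝓘(ℝ, ℝ) ∞ (fun x => ⟪covec x, a⟫_ℝ) := by
    have h1 : ContMDiff ICot ICot ∞ (fun x : CotangentS2 => x) := contMDiff_id
    have h2 : ContMDiff ICot (𝓡 2).tangent ∞ (fun x : CotangentS2 =>
      (⟨x.1, tangentProj x.1 a⟩ : TangentBundle (𝓡 2) S2)) :=
      (contMDiff_tangentProj a).comp (Bundle.contMDiff_proj _)
    have h3 := ContMDiff.clm_bundle_apply (F₁ := EuclideanSpace ℝ (Fin 2)) (F₂ := ℝ)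
      (E₁ := fun q : S2 => TangentSpace (𝓡 2) q) (E₂ := fun _ : S2 => ℝ)
      (b := fun x : CotangentS2 => x.1) (ϕ := fun x => x.2) (v := fun x => tangentProj x.1 a) h1 h2
    intro x
    have h4 := (Bundle.contMDiffAt_totalSpace.1 (h3 x)).2
    simpa [inner_covec] using h4
  have h2 : ContMDiff ICot 𝓘(ℝ, E3) ∞ (fun x : CotangentS2 =>
      ∑ i, ⟪covec x, EuclideanSpace.basisFun (Fin 3) ℝ i⟫_ℝ • EuclideanSpace.basisFun (Fin 3) ℝ i) :=
    contMDiff_finsetSum fun i _ => (h _).smul contMDiff_const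
  refine h2.congr fun x => ?_
  simp_rw [fun a => real_inner_comm a (covec x)]
  exact ((EuclideanSpace.basisFun (Fin 3) ℝ).sum_repr' _).symm

theorem contMDiff_footPoint {m : WithTop ℕ∞} : ContMDiff ICot (𝓡 2) m footPoint :=
  Bundle.contMDiff_proj _

/-- The embedding `(q, p) ↦ (q, v)` of `T^*S²` in `E3 × E3`. -/
def emb (x : CotangentS2) : E3 × E3 := ((x.1 : E3), covec x)

theorem contMDiff_emb : ContMDiff ICot 𝓘(ℝ, E3 × E3) ∞ emb :=
  (contMDiff_coe_S2.comp contMDiff_footPoint).prodMk_space contMDiff_covec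

/-- A smooth left inverse of `emb`, defined near its image. -/
def retr (z : E3 × E3) : CotangentS2 :=
  ⟨normalize z.1, innerSL ℝ z.2 ∘L dIncl (normalize z.1)⟩

theorem retr_coe (q : S2) (v : E3) : retr ((q : E3), v) = ⟨q, innerSL ℝ v ∘L dIncl q⟩ := by
  have : ∀ q' : S2, q' = q → (⟨q', innerSL ℝ v ∘L dIncl q'⟩ : CotangentS2)
    = ⟨q, innerSL ℝ v ∘L dIncl q⟩ := by rintro _ rfl; rfl
  exact this _ (normalize_coe q)

theorem retr_emb (x : CotangentS2) : retr (emb x) = x := by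
  rw [emb, retr_coe]
  obtain ⟨q, p⟩ := x
  congr 1
  ext u
  exact inner_covec_dIncl ⟨q, p⟩ u

theorem emb_injective : Function.Injective emb := Function.LeftInverse.injective retr_emb

/-- Together with `retr_emb`, this identifies the image of `emb`; a map of E3 × E3 preserving these
two constraints can thus be conjugated to `T^*S²`. -/
theorem emb_retr {a v : E3} (ha : ‖a‖ = 1) (h : ⟪a, v⟫_ℝ = 0) : emb (retr (a, v)) = (a, v) := by
  lift a to S2 using by simpa using ha
  rw [retr_coe]
  refine Prod.ext rfl (ext_inner_right ℝ fun b => ?_)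
  rw [emb, inner_covec]
  rw [real_inner_comm] at h
  simp [dIncl_tangentProj, inner_sub_right, inner_smul_right, h]

/-- In bundle coordinates the covector is ⟪v, ·⟫ composed with the differential of the inclusion at
`normalize z.1`; both factors vary smoothly. -/
theorem contMDiffAt_retr {z : E3 × E3} (hz : z.1 ≠ 0) :
    ContMDiffAt 𝓘(ℝ, E3 × E3) ICot ∞ retr z := by
  rw [contMDiffAt_hom_bundle]
  have hN : ContMDiffAt 𝓘(ℝ, E3 × E3) (𝓡 2) ∞ (fun z : E3 × E3 => normalize z.1) z :=
    (contMDiffAt_normalize hz).comp z contDiff_fst.contMDiff.contMDiffAt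
  refine ⟨hN, ?_⟩
  have h1 := ((contMDiff_coe_S2 (m := ∞)).contMDiffAt (x := normalize z.1)).mfderiv_const
    (m := ∞) (by simp)
  have h2 := h1.comp z hN
  have h3 : ContMDiffAt 𝓘(ℝ, E3 × E3) 𝓘(ℝ, E3 →L[ℝ] ℝ) ∞ (fun z : E3 × E3 => innerSL ℝ z.2) z :=
    ((innerSL ℝ (E := E3)).contDiff.comp contDiff_snd).contMDiff.contMDiffAt
  have h4 := h3.clm_comp h2
  refine h4.congr_of_eventuallyEq (Filter.Eventually.of_forall fun y => ?_)
  ext u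
  simp [ContinuousLinearMap.inCoordinates, inTangentCoordinates, retr]
  rfl

/-- Cauchy–Schwarz bounds the dual norm from above; testing p on its own dual vector shows that the
bound is optimal. -/
theorem conorm_eq (x : CotangentS2) : conorm x = ‖covec x‖ := by
  have hs (u : TangentSpace (𝓡 2) x.1) : √(roundMetric x.1 u u) = ‖dIncl x.1 u‖ := by
    rw [roundMetric, real_inner_self_eq_norm_sq, Real.sqrt_sq (norm_nonneg _)]
  refine IsLeast.csInf_eq ⟨⟨norm_nonneg _, fun u => ?_⟩, ?_⟩
  · rw [hs, ← inner_covec_dIncl]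
    exact abs_real_inner_le_norm _ _
  · rintro c ⟨hc, h⟩
    have h1 := h (tangentProj x.1 (covec x))
    rw [hs, ← inner_covec_dIncl,
      dIncl_tangentProj_of_inner_eq_zero (inner_coe_covec x), real_inner_self_eq_norm_sq,
      abs_of_nonneg (sq_nonneg _)] at h1
    by_contra! hlt
    have : 0 < ‖covec x‖ := hc.trans_lt hlt
    nlinarith

end Embedding

/-! ### The canonical and twisted forms computed in E3 × E3 -/

section LiouvilleForm

section Naturality

variable {E : Type*} [NormedAddCommGroup E] [NormedSpace ℝ E]
  {H : Type*} [TopologicalSpace H] {I : ModelWithCorners ℝ E H} [I.Boundaryless]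
  {M : Type*} [TopologicalSpace M] [ChartedSpace H M] [IsManifold I ∞ M]
  {V : Type*} [NormedAddCommGroup V] [NormedSpace ℝ V]

/-- The exterior derivative commutes with the pull-back by a smooth map to a vector space. -/
theorem DiffForm.d_eq_of_pullback {k : ℕ} {α : DiffForm I (M := M) k}
    {β : V → V [⋀^Fin k]→L[ℝ] ℝ} {f : M → V} (hf : ContMDiff I 𝓘(ℝ, V) ∞ f)
    (hβ : Differentiable ℝ β)
    (hα : ∀ x, α x = (β (f x)).compContinuousLinearMap (mvfderiv I f x)) (x : M) :
    α.d x = (extDeriv β (f x)).compContinuousLinearMap (mvfderiv I f x) := by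
  have : IsManifold I 1 M := IsManifold.of_le (n := ∞) (by simp)
  set φ := extChartAt I x with hφ
  set g : E → V := fun y => f (φ.symm y) with hg
  have ht : φ.target ∈ nhds (φ x) := extChartAt_target_mem_nhds x
  have hsymm : ContMDiffOn 𝓘(ℝ, E) I ∞ φ.symm φ.target := contMDiffOn_extChartAt_symm x
  have hto : IsOpen φ.target := isOpen_extChartAt_target x
  have hgs : ContDiffOn ℝ ∞ g φ.target := (hf.comp_contMDiffOn hsymm).contDiffOn
  have hfd (y : E) (hy : y ∈ φ.target) :
      (mvfderiv I f (φ.symm y)) ∘L (mfderiv 𝓘(ℝ, E) I φ.symm y) = fderiv ℝ g y := by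
    have h1 : HasMFDerivAt I 𝓘(ℝ, V) f (φ.symm y) (mvfderiv I f (φ.symm y)) :=
      (hf.mdifferentiableAt (by simp)).hasMFDerivAt
    have h2 : HasMFDerivAt 𝓘(ℝ, E) I φ.symm y (mfderiv 𝓘(ℝ, E) I φ.symm y) :=
      ((hsymm.contMDiffAt (hto.mem_nhds hy)).mdifferentiableAt (by simp)).hasMFDerivAt
    have h3 : HasMFDerivAt 𝓘(ℝ, E) 𝓘(ℝ, V) g y _ := h1.comp y h2
    rw [← mfderiv_eq_fderiv]
    exact h3.mfderiv.symm
  -- In the chart, α is the pull-back of β by g = f ∘ φ⁻¹, so the vector-space rule for `extDeriv`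
  -- applies; pulling back by φ then restores f.
  have hch : α.inChart x =ᶠ[nhds (φ x)]
      fun y => (β (g y)).compContinuousLinearMap (fderiv ℝ g y) := by
    filter_upwards [ht] with y hy
    rw [DiffForm.inChart, hα, ← hfd y hy]
    rfl
  have hx : φ.symm (φ x) = x := extChartAt_to_inv x
  have hgx : g (φ x) = f x := by rw [hg]; simp only [hx]
  rw [DiffForm.d, hch.extDeriv_eq, extDeriv_pullback (r := ∞) (hβ _) (hgs.contDiffAt ht)
    (by simpa using WithTop.coe_le_coe.2 (le_top (a := (2 : ℕ∞)))),
    hgx]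
  have h4 : (fderiv ℝ g (φ x)) ∘L (mfderiv I 𝓘(ℝ, E) φ x) = mvfderiv I f x := by
    have h1 : HasMFDerivAt 𝓘(ℝ, E) 𝓘(ℝ, V) g (φ x) (fderiv ℝ g (φ x)) :=
      ((hgs.contDiffAt ht).differentiableAt (by simp)).hasFDerivAt.hasMFDerivAt
    have h2 : HasMFDerivAt I 𝓘(ℝ, E) φ x (mfderiv I 𝓘(ℝ, E) φ x) :=
      (mdifferentiableAt_extChartAt (mem_chart_source H x)).hasMFDerivAt
    have h3 := h1.comp x h2
    have h5 : HasMFDerivAt I 𝓘(ℝ, V) f x (mvfderiv I f x) :=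
      (hf.mdifferentiableAt (by simp)).hasMFDerivAt
    refine hasMFDerivAt_unique (h3.congr_of_eventuallyEq ?_) h5
    filter_upwards [extChartAt_source_mem_nhds (I := I) x] with y hy
    simp only [hg, Function.comp]
    rw [φ.left_inv hy]
  rw [← h4]
  rfl

end Naturality

/-- The form `b · da` on `E3 × E3`. -/
def liouvilleE3 (z : E3 × E3) : (E3 × E3) [⋀^Fin 1]→L[ℝ] ℝ :=
  ContinuousAlternatingMap.ofSubsingleton ℝ (E3 × E3) ℝ (0 : Fin 1)
    (innerSL ℝ z.2 ∘L ContinuousLinearMap.fst ℝ E3 E3)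

theorem differentiable_liouvilleE3 : Differentiable ℝ liouvilleE3 := by
  let T : (E3 × E3 →L[ℝ] ℝ) ≃ₗᵢ[ℝ] ((E3 × E3) [⋀^Fin 1]→L[ℝ] ℝ) :=
    ContinuousAlternatingMap.ofSubsingletonLIE (0 : Fin 1)
  let L : (E3 × E3) →L[ℝ] (E3 × E3 →L[ℝ] ℝ) :=
    ((ContinuousLinearMap.compL ℝ (E3 × E3) E3 ℝ).flip (ContinuousLinearMap.fst ℝ E3 E3)) ∘L
      (innerSL ℝ (E := E3)) ∘L ContinuousLinearMap.snd ℝ E3 E3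
  exact T.differentiable.comp L.differentiable

theorem extDeriv_liouvilleE3 (z : E3 × E3) (v : Fin 2 → E3 × E3) :
    extDeriv liouvilleE3 z v = ⟪(v 0).2, (v 1).1⟫_ℝ - ⟪(v 1).2, (v 0).1⟫_ℝ := by
  have h (w ξ : E3 × E3) :
      fderiv ℝ (fun z : E3 × E3 => ⟪z.2, w.1⟫_ℝ) z ξ = ⟪ξ.2, w.1⟫_ℝ := by
    have : HasFDerivAt (fun z : E3 × E3 => ⟪z.2, w.1⟫_ℝ)
      ((innerSL ℝ w.1) ∘L ContinuousLinearMap.snd ℝ E3 E3) z := by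
      refine ((innerSL ℝ w.1) ∘L ContinuousLinearMap.snd ℝ E3 E3).hasFDerivAt.congr_of_eventuallyEq
        (Filter.Eventually.of_forall fun y => ?_)
      simp [real_inner_comm]
    rw [this.fderiv]
    simp [real_inner_comm]
  rw [extDeriv_apply (differentiable_liouvilleE3 z)]
  have h0 (i : Fin 2) (y : E3 × E3) :
    liouvilleE3 y (i.removeNth v) = ⟪y.2, (i.removeNth v 0).1⟫_ℝ := rfl
  simp_rw [h0, h]
  simp [Fin.sum_univ_two, Fin.removeNth]
  ring_nf

/-- The differential of the embedding of `T^*S²` in `E3 × E3`. -/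
def dEmb (x : CotangentS2) : TangentSpace ICot x →L[ℝ] E3 × E3 := mvfderiv ICot emb x

theorem hasMFDerivAt_emb (x : CotangentS2) : HasMFDerivAt ICot 𝓘(ℝ, E3 × E3) emb x (dEmb x) :=
  (contMDiff_emb.mdifferentiableAt (by simp)).hasMFDerivAt

theorem dEmb_fst (x : CotangentS2) (ξ : TangentSpace ICot x) :
    (dEmb x ξ).1 = dIncl x.1 (mfderiv ICot (𝓡 2) footPoint x ξ) := by
  have h1 : HasMFDerivAt ICot 𝓘(ℝ, E3) (fun y => (emb y).1) x
      ((ContinuousLinearMap.fst ℝ E3 E3) ∘L dEmb x) :=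
    HasMFDerivAt.comp x (hasFDerivAt_fst (p := emb x)).hasMFDerivAt (hasMFDerivAt_emb x)
  have h2 : HasMFDerivAt ICot 𝓘(ℝ, E3) (fun y => (emb y).1) x
      (dIncl x.1 ∘L mfderiv ICot (𝓡 2) footPoint x) :=
    HasMFDerivAt.comp (f := footPoint) x (mdifferentiableAt_coe_S2 x.1).hasMFDerivAt
      ((contMDiff_footPoint (m := ∞)).mdifferentiableAt (by simp)).hasMFDerivAt
  exact congrArg (fun L => L ξ) (hasMFDerivAt_unique h1 h2)

theorem liouville_eq (x : CotangentS2) :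
    liouville x = (liouvilleE3 (emb x)).compContinuousLinearMap (dEmb x) := by
  ext v
  change x.2 (mfderiv ICot (𝓡 2) footPoint x (v 0)) = ⟪(emb x).2, (dEmb x (v 0)).1⟫_ℝ
  rw [dEmb_fst]
  exact (inner_covec_dIncl x _).symm

theorem liouville_d_apply (x : CotangentS2) (v : Fin 2 → TangentSpace ICot x) :
    liouville.d x v = ⟪(dEmb x (v 0)).2, (dEmb x (v 1)).1⟫_ℝ
      - ⟪(dEmb x (v 1)).2, (dEmb x (v 0)).1⟫_ℝ := by
  rw [DiffForm.d_eq_of_pullback contMDiff_emb differentiable_liouvilleE3 liouville_eq]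
  exact extDeriv_liouvilleE3 _ _

theorem twistedForm_apply (o : Orientation ℝ E3 (Fin 3)) (s : ℝ) (x : CotangentS2)
    (v : Fin 2 → TangentSpace ICot x) :
    twistedForm o s x v = ⟪(dEmb x (v 0)).2, (dEmb x (v 1)).1⟫_ℝ
      - ⟪(dEmb x (v 1)).2, (dEmb x (v 0)).1⟫_ℝ
      - s * volE3 o ![(x.1 : E3), (dEmb x (v 0)).1, (dEmb x (v 1)).1] := by
  have h : twistedForm o s x v = liouville.d x v
    - s * volE3 o (Matrix.vecCons (x.1 : E3)
      fun i => dIncl x.1 (mfderiv ICot (𝓡 2) footPoint x (v i))) := rfl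
  rw [h, liouville_d_apply, dEmb_fst, dEmb_fst]
  congr 4
  ext i
  fin_cases i <;> rfl

theorem inner_dEmb_fst (x : CotangentS2) (ξ : TangentSpace ICot x) :
    ⟪(x.1 : E3), (dEmb x ξ).1⟫_ℝ = 0 := by
  rw [dEmb_fst]; exact inner_dIncl _ _

/-- The differentiated relation `⟪q, v⟫ = 0`. -/
theorem inner_dEmb_add (x : CotangentS2) (ξ : TangentSpace ICot x) :
    ⟪(x.1 : E3), (dEmb x ξ).2⟫_ℝ + ⟪(dEmb x ξ).1, covec x⟫_ℝ = 0 := by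
  have h1 : HasFDerivAt (fun z : E3 × E3 => ⟪z.1, z.2⟫_ℝ) _ (emb x) :=
    (hasFDerivAt_fst (𝕜 := ℝ)).inner ℝ hasFDerivAt_snd
  have h2 := h1.hasMFDerivAt.comp x (hasMFDerivAt_emb x)
  have h3 : HasMFDerivAt ICot 𝓘(ℝ, ℝ) (fun _ : CotangentS2 => (0 : ℝ)) x 0 := hasMFDerivAt_const _ _
  have h4 := h3.congr_of_eventuallyEq
    (f₁ := (fun z : E3 × E3 => ⟪z.1, z.2⟫_ℝ) ∘ emb)
    (Filter.Eventually.of_forall fun y => inner_coe_covec y)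
  have h5 := congrArg (fun L => L ξ) (hasMFDerivAt_unique h2 h4)
  exact h5

end LiouvilleForm

section CrossProduct

/-! ### The cross product of an oriented Euclidean three-space -/

theorem volE3_apply_eq_volumeForm (o : Orientation ℝ E3 (Fin 3)) (v : Fin 3 → E3) :
    have : Fact (Module.finrank ℝ E3 = 3) := ⟨finrank_euclideanSpace_fin⟩
    volE3 o v = o.volumeForm v := rfl

/-- The determinant of three vectors of `E3`. -/
def detE3 (u v w : E3) : ℝ :=
  u 0 * (v 1 * w 2 - v 2 * w 1) + u 1 * (v 2 * w 0 - v 0 * w 2) + u 2 * (v 0 * w 1 - v 1 * w 0)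

/-- An orientation is the standard one or its opposite. Carrying the sign σ handles both at once,
and only σ² = 1 is needed. -/
theorem exists_sign (o : Orientation ℝ E3 (Fin 3)) :
    ∃ σ : ℝ, σ * σ = 1 ∧ ∀ u v w : E3, volE3 o ![u, v, w] = σ * detE3 u v w := by
  have : Fact (Module.finrank ℝ E3 = 3) := ⟨finrank_euclideanSpace_fin⟩
  have hdet (u v w : E3) :
      (EuclideanSpace.basisFun (Fin 3) ℝ).toBasis.det ![u, v, w] = detE3 u v w := by
    rw [Module.Basis.det_apply, Matrix.det_fin_three, detE3]
    simp [Module.Basis.toMatrix_apply]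
    ring
  rcases Orientation.eq_or_eq_neg (EuclideanSpace.basisFun (Fin 3) ℝ).toBasis.orientation o
    (by simp) with h | h
  · refine ⟨1, by norm_num, fun u v w => ?_⟩
    rw [volE3_apply_eq_volumeForm, o.volumeForm_robust _ h, hdet, one_mul]
  · refine ⟨-1, by norm_num, fun u v w => ?_⟩
    rw [volE3_apply_eq_volumeForm, o.volumeForm_robust_neg (EuclideanSpace.basisFun (Fin 3) ℝ)
      (by
        intro h'
        exact Module.Ray.ne_neg_self _ (h'.symm ▸ h))]
    simp [hdet]

/-- The sign of an orientation of `E3` relative to the standard one. -/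
def orSign (o : Orientation ℝ E3 (Fin 3)) : ℝ := (exists_sign o).choose

theorem orSign_mul_self (o : Orientation ℝ E3 (Fin 3)) : orSign o * orSign o = 1 :=
  (exists_sign o).choose_spec.1

theorem volE3_apply (o : Orientation ℝ E3 (Fin 3)) (u v w : E3) :
    volE3 o ![u, v, w] = orSign o * detE3 u v w :=
  (exists_sign o).choose_spec.2 u v w

/-- The cross product of an orientation of `E3`. -/
def cross (o : Orientation ℝ E3 (Fin 3)) : E3 →L[ℝ] E3 →L[ℝ] E3 :=
  LinearMap.toContinuousLinearMap (LinearMap.toContinuousLinearMap.toLinearMap ∘ₗ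
    LinearMap.mk₂ ℝ (fun u v : E3 => orSign o •
      (!₂[u 1 * v 2 - u 2 * v 1, u 2 * v 0 - u 0 * v 2, u 0 * v 1 - u 1 * v 0] : E3))
      (fun u u' v => by ext i; fin_cases i <;> simp <;> ring)
      (fun c u v => by ext i; fin_cases i <;> simp <;> ring)
      (fun u v v' => by ext i; fin_cases i <;> simp <;> ring)
      (fun c u v => by ext i; fin_cases i <;> simp <;> ring))

variable (o : Orientation ℝ E3 (Fin 3))

theorem cross_apply (u v : E3) : cross o u v = orSign o •
    (!₂[u 1 * v 2 - u 2 * v 1, u 2 * v 0 - u 0 * v 2, u 0 * v 1 - u 1 * v 0] : E3) := rfl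

theorem inner_E3 (u v : E3) : ⟪u, v⟫_ℝ = u 0 * v 0 + u 1 * v 1 + u 2 * v 2 := by
  simp [PiLp.inner_apply, Fin.sum_univ_three, mul_comm]

theorem inner_cross (u v w : E3) : ⟪cross o u v, w⟫_ℝ = volE3 o ![u, v, w] := by
  rw [volE3_apply, inner_E3, cross_apply, detE3]
  simp
  ring

theorem inner_cross_left (u v : E3) : ⟪u, cross o u v⟫_ℝ = 0 := by
  rw [inner_E3, cross_apply]; simp; ring

theorem inner_cross_right (u v : E3) : ⟪v, cross o u v⟫_ℝ = 0 := by
  rw [inner_E3, cross_apply]; simp; ring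

theorem cross_self (u : E3) : cross o u u = 0 := by
  rw [cross_apply]; ext i; fin_cases i <;> simp <;> ring_nf <;> simp

theorem cross_swap (u v : E3) : cross o u v = -cross o v u := by
  rw [cross_apply, cross_apply]; ext i; fin_cases i <;> simp <;> ring

theorem cross_cross (u v w : E3) :
    cross o u (cross o v w) = ⟪u, w⟫_ℝ • v - ⟪u, v⟫_ℝ • w := by
  rw [inner_E3, inner_E3, cross_apply o v w, map_smul, cross_apply, smul_smul, orSign_mul_self,
    one_smul]
  ext i; fin_cases i <;> simp <;> ring

theorem inner_cross_cross (u v u' v' : E3) :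
    ⟪cross o u v, cross o u' v'⟫_ℝ = ⟪u, u'⟫_ℝ * ⟪v, v'⟫_ℝ - ⟪u, v'⟫_ℝ * ⟪v, u'⟫_ℝ := by
  simp only [inner_E3, cross_apply]
  simp
  linear_combination ((u 1 * v 2 - u 2 * v 1) * (u' 1 * v' 2 - u' 2 * v' 1)
    + (u 2 * v 0 - u 0 * v 2) * (u' 2 * v' 0 - u' 0 * v' 2)
    + (u 0 * v 1 - u 1 * v 0) * (u' 0 * v' 1 - u' 1 * v' 0)) * orSign_mul_self o

/-- Expansion of a vector in the orthogonal frame `(q, v, q × v)`. -/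
theorem smul_eq_frame {q v : E3} (hq : ⟪q, q⟫_ℝ = 1) (hv : ⟪q, v⟫_ℝ = 0) (x : E3) :
    ⟪v, v⟫_ℝ • x = (⟪v, v⟫_ℝ * ⟪q, x⟫_ℝ) • q + ⟪v, x⟫_ℝ • v
      + ⟪cross o q v, x⟫_ℝ • cross o q v := by
  have hw : ⟪cross o q v, cross o q v⟫_ℝ = ⟪v, v⟫_ℝ := by
    rw [inner_cross_cross, hq, hv]; ring
  -- With w = q × v, expand w × (w × x) in two ways, using w × q = v and w × v = -|v|² q.
  have h1 := cross_cross o (cross o q v) (cross o q v) x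
  have hvq : ⟪v, q⟫_ℝ = 0 := by rw [real_inner_comm, hv]
  have hq' : cross o (cross o q v) q = v := by
    rw [cross_swap, cross_cross, hq, hv]; module
  have hv' : cross o (cross o q v) v = -(⟪v, v⟫_ℝ • q) := by
    rw [cross_swap, cross_cross, hvq]; module
  rw [hw, cross_swap o (cross o q v) x, cross_cross, map_neg, map_sub, map_smul, map_smul,
    hq', hv', real_inner_comm v x, real_inner_comm q x] at h1
  linear_combination (norm := module) h1

theorem exists_frame_coord {q v : E3} (hq : ⟪q, q⟫_ℝ = 1) (hv : ⟪q, v⟫_ℝ = 0) 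
    (hρ : ⟪v, v⟫_ℝ ≠ 0) (x : E3) :
    ∃ x₂ x₃ : ℝ, x = ⟪q, x⟫_ℝ • q + x₂ • v + x₃ • cross o q v ∧ x₂ * ⟪v, v⟫_ℝ = ⟪v, x⟫_ℝ := by
  refine ⟨⟪v, x⟫_ℝ / ⟪v, v⟫_ℝ, ⟪cross o q v, x⟫_ℝ / ⟪v, v⟫_ℝ, ?_, by field_simp⟩
  have h := congrArg (fun y => (⟪v, v⟫_ℝ)⁻¹ • y) (smul_eq_frame o hq hv x)
  simp only [smul_smul, smul_add, inv_mul_cancel₀ hρ, one_smul, inv_mul_cancel_left₀ hρ] at h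
  simpa only [div_eq_inv_mul] using h

theorem inner_frame {q v : E3} (hq : ⟪q, q⟫_ℝ = 1) (hv : ⟪q, v⟫_ℝ = 0) 
    (x₁ x₂ x₃ y₁ y₂ y₃ : ℝ) :
    ⟪x₁ • q + x₂ • v + x₃ • cross o q v, y₁ • q + y₂ • v + y₃ • cross o q v⟫_ℝ
      = x₁ * y₁ + ⟪v, v⟫_ℝ * (x₂ * y₂ + x₃ * y₃) := by
  have hvq : ⟪v, q⟫_ℝ = 0 := by rw [real_inner_comm, hv]
  have hw : ⟪cross o q v, cross o q v⟫_ℝ = ⟪v, v⟫_ℝ := by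
    rw [inner_cross_cross, hq, hv]; ring
  have hwq : ⟪cross o q v, q⟫_ℝ = 0 := by rw [real_inner_comm, inner_cross_left]
  have hwv : ⟪cross o q v, v⟫_ℝ = 0 := by rw [real_inner_comm, inner_cross_right]
  simp only [inner_add_left, inner_add_right, real_inner_smul_left, real_inner_smul_right, hq, hv,
    hvq, hw, inner_cross_left, inner_cross_right, hwq, hwv]
  ring

theorem cross_frame {q v : E3} (hq : ⟪q, q⟫_ℝ = 1) (hv : ⟪q, v⟫_ℝ = 0) 
    (x₁ x₂ x₃ y₁ y₂ y₃ : ℝ) :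
    cross o (x₁ • q + x₂ • v + x₃ • cross o q v) (y₁ • q + y₂ • v + y₃ • cross o q v)
      = (⟪v, v⟫_ℝ * (x₂ * y₃ - x₃ * y₂)) • q + (x₃ * y₁ - x₁ * y₃) • v
        + (x₁ * y₂ - x₂ * y₁) • cross o q v := by
  have hvq : ⟪v, q⟫_ℝ = 0 := by rw [real_inner_comm, hv]
  have hwq : cross o (cross o q v) q = v := by
    rw [cross_swap, cross_cross, hq, hv]; module
  have hwv : cross o (cross o q v) v = -(⟪v, v⟫_ℝ • q) := by
    rw [cross_swap, cross_cross, hvq]; module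
  simp only [map_add, map_smul, add_apply, smul_apply,
    cross_self, cross_swap o v q, hwq, hwv, cross_cross, hq, hv, hvq]
  module

/-- The left side is the derivative of c q + k q × v along (a, b), with dc and dk the increments of
c and k; a has no q-component because the sphere is tangent to it. -/
theorem velocity_frame {q v a b : E3} (hq : ⟪q, q⟫_ℝ = 1) (hv : ⟪q, v⟫_ℝ = 0)
    {α₂ α₃ β₁ β₂ β₃ : ℝ} (ha : a = (0 : ℝ) • q + α₂ • v + α₃ • cross o q v)
    (hb : b = β₁ • q + β₂ • v + β₃ • cross o q v) (c k dc dk : ℝ) :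
    dc • q + c • a + dk • cross o q v + k • (cross o a v + cross o q b)
      = (dc - k * ⟪v, v⟫_ℝ * α₃) • q + (c * α₂ - k * β₃) • v
        + (c * α₃ + dk + k * β₂) • cross o q v := by
  have h1 := cross_frame o hq hv 0 α₂ α₃ 0 1 0
  have h2 := cross_frame o hq hv 1 0 0 β₁ β₂ β₃
  rw [← ha, show (0 : ℝ) • q + (1 : ℝ) • v + (0 : ℝ) • cross o q v = v by module] at h1
  rw [← hb, show (1 : ℝ) • q + (0 : ℝ) • v + (0 : ℝ) • cross o q v = q by module] at h2
  rw [h1, h2, ha]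
  module

/-- The algebraic identity behind the relation between the canonical and the twisted symplectic
forms: it is the relation at a point `(q, v)`, on tangent vectors `(a, b)` and `(a', b')`, for the
map `(q, v) ↦ (c q + k q × v, c v)` with `c² + k² |v|² = 1` and `k |v|² = s` constant. -/
theorem twist_identity {q v a b a' b' : E3} {c k s dc dk dc' dk' : ℝ} (hq : ⟪q, q⟫_ℝ = 1)
    (hv : ⟪q, v⟫_ℝ = 0) (hρ : ⟪v, v⟫_ℝ ≠ 0) (hck : c ^ 2 + k ^ 2 * ⟪v, v⟫_ℝ = 1)
    (hs : k * ⟪v, v⟫_ℝ = s)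
    (ha : ⟪q, a⟫_ℝ = 0) (hb : ⟪q, b⟫_ℝ + ⟪a, v⟫_ℝ = 0)
    (ha' : ⟪q, a'⟫_ℝ = 0) (hb' : ⟪q, b'⟫_ℝ + ⟪a', v⟫_ℝ = 0)
    (hdc : c * dc = k ^ 2 * ⟪v, b⟫_ℝ) (hdk : dk * ⟪v, v⟫_ℝ = -(2 * k * ⟪v, b⟫_ℝ))
    (hdc' : c * dc' = k ^ 2 * ⟪v, b'⟫_ℝ) (hdk' : dk' * ⟪v, v⟫_ℝ = -(2 * k * ⟪v, b'⟫_ℝ)) :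
    ⟪dc • v + c • b, dc' • q + c • a' + dk' • cross o q v + k • (cross o a' v + cross o q b')⟫_ℝ
      - ⟪dc' • v + c • b', dc • q + c • a + dk • cross o q v + k • (cross o a v + cross o q b)⟫_ℝ
      - s * volE3 o ![c • q + k • cross o q v,
          dc • q + c • a + dk • cross o q v + k • (cross o a v + cross o q b),
          dc' • q + c • a' + dk' • cross o q v + k • (cross o a' v + cross o q b')]
      = ⟪b, a'⟫_ℝ - ⟪b', a⟫_ℝ := by
  obtain ⟨α₂, α₃, ea, ha₂⟩ := exists_frame_coord o hq hv hρ a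
  obtain ⟨β₂, β₃, eb, hb₂⟩ := exists_frame_coord o hq hv hρ b
  obtain ⟨α₂', α₃', ea', ha₂'⟩ := exists_frame_coord o hq hv hρ a'
  obtain ⟨β₂', β₃', eb', hb₂'⟩ := exists_frame_coord o hq hv hρ b'
  rw [real_inner_comm v a, ← ha₂] at hb
  rw [real_inner_comm v a', ← ha₂'] at hb'
  rw [ha] at ea
  rw [ha'] at ea'
  rw [eq_neg_of_add_eq_zero_left hb] at eb
  rw [eq_neg_of_add_eq_zero_left hb'] at eb'
  rw [← hb₂] at hdc hdk
  rw [← hb₂'] at hdc' hdk'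
  have hdk : dk = -(2 * k * β₂) := mul_right_cancel₀ hρ (by rw [hdk]; ring)
  have hdk' : dk' = -(2 * k * β₂') := mul_right_cancel₀ hρ (by rw [hdk']; ring)
  rw [velocity_frame o hq hv ea eb, velocity_frame o hq hv ea' eb',
    show c • q + k • cross o q v = c • q + (0 : ℝ) • v + k • cross o q v by module,
    ← inner_cross, cross_frame o hq hv, inner_frame o hq hv,
    show dc • v + c • b = -(c * (α₂ * ⟪v, v⟫_ℝ)) • q + (dc + c * β₂) • v + (c * β₃) • cross o q v by
      rw [eb]; module,
    show dc' • v + c • b'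
      = -(c * (α₂' * ⟪v, v⟫_ℝ)) • q + (dc' + c * β₂') • v + (c * β₃') • cross o q v by
      rw [eb']; module,
    inner_frame o hq hv, inner_frame o hq hv]
  conv_rhs => rw [ea, eb, ea', eb', inner_frame o hq hv, inner_frame o hq hv]
  rw [hdk, hdk', ← hs]
  -- What remains is a polynomial identity in the frame coordinates, modulo c² + k²ρ = 1 and the
  -- relations for c dc and c dc'. No division by c is needed.
  generalize ⟪v, v⟫_ℝ = ρ at *
  linear_combination (ρ * c * (c * α₂' - k * β₃') + ρ * α₂') * hdc
    - (ρ * c * (c * α₂ - k * β₃) + ρ * α₂) * hdc'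
    + (-ρ * dc * (c * α₂' - k * β₃') + ρ * dc' * (c * α₂ - k * β₃)
      - k * ρ ^ 2 * ((c * α₂ - k * β₃) * α₃' - α₃ * (c * α₂' - k * β₃'))
      + ρ * (β₂ * α₂' - β₂' * α₂ + β₃ * α₃' - β₃' * α₃)) * hck

end CrossProduct

section Isometries

/-! ### Isometries of the round sphere -/

open InnerProductGeometry Filter Topology

/-- A chord subtending the angle θ on the unit sphere has length 2 sin(θ/2). -/
theorem angle_le_of_norm_sub_le {u v : E3} (hu : ‖u‖ = 1) (hv : ‖v‖ = 1) {δ : ℝ}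
    (h : ‖u - v‖ ≤ δ) : angle u v ≤ 2 * Real.arcsin (δ / 2) := by
  have h1 : Real.sin (angle u v / 2) = ‖u - v‖ / 2 := by
    have h2 : ‖u - v‖ ^ 2 = 2 - 2 * Real.cos (angle u v) := by
      rw [norm_sub_sq_real, hu, hv, ← cos_angle_mul_norm_mul_norm, hu, hv]; ring
    have h3 : Real.cos (angle u v) = 1 - 2 * Real.sin (angle u v / 2) ^ 2 := by
      have := Real.cos_two_mul (angle u v / 2)
      have h4 := Real.sin_sq_add_cos_sq (angle u v / 2)
      rw [show 2 * (angle u v / 2) = angle u v by ring] at this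
      linarith
    have h5 : 0 ≤ Real.sin (angle u v / 2) :=
      Real.sin_nonneg_of_nonneg_of_le_pi (by linarith [angle_nonneg u v])
        (by linarith [angle_le_pi u v, Real.pi_pos])
    have h6 : (2 * Real.sin (angle u v / 2)) ^ 2 = ‖u - v‖ ^ 2 := by rw [h2, h3]; ring
    have h7 := (sq_eq_sq₀ (by positivity) (norm_nonneg _)).1 h6
    linarith
  have h2 : Real.arcsin (‖u - v‖ / 2) = angle u v / 2 := by
    rw [← h1]
    exact Real.arcsin_sin (by linarith [angle_nonneg u v, Real.pi_pos])
      (by linarith [angle_le_pi u v])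
  have h3 := Real.monotone_arcsin (show ‖u - v‖ / 2 ≤ δ / 2 by linarith)
  linarith

/-- On the unit sphere, the angle between the end points of a curve is at most its length. -/
theorem angle_le_of_lipschitz {c : ℝ → E3} (hc : ∀ t, ‖c t‖ = 1)
    (hL : ∀ s t, ‖c s - c t‖ ≤ |s - t|) {t : ℝ} (ht : 0 ≤ t) : angle (c 0) (c t) ≤ t := by
  have hn (n : ℕ) (h : ℝ) (hh : 0 ≤ h) : angle (c 0) (c (n * h)) ≤ n * (2 * Real.arcsin (h / 2)) := by
    induction n with
    | zero =>
      have : c 0 ≠ 0 := by intro h0; have := hc 0; simp [h0] at this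
      simp [angle_self this]
    | succ n ih =>
      have h1 := angle_le_angle_add_angle (c 0) (c (n * h)) (c ((n + 1 : ℕ) * h))
      have h2 := angle_le_of_norm_sub_le (hc (n * h)) (hc ((n + 1 : ℕ) * h)) (hL _ _)
      rw [show (n * h - (n + 1 : ℕ) * h) = -h by push_cast; ring, abs_neg, abs_of_nonneg hh] at h2
      push_cast at h1 h2 ⊢
      linarith
  -- Subdividing into n chords loses nothing in the limit: this is the derivative at 0 of x ↦ 2
  -- arcsin(t x / 2).
  have hlim : Tendsto (fun n : ℕ => (n : ℝ) * (2 * Real.arcsin (t / n / 2))) atTop (𝓝 t) := by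
    have h1 : HasDerivAt (fun x => 2 * Real.arcsin (t * x / 2)) t 0 := by
      have h2 : HasDerivAt Real.arcsin 1 (t * 0 / 2) := by
        have := Real.hasDerivAt_arcsin (x := 0) (by norm_num) (by norm_num)
        simpa using this
      have h3 := (h2.comp (0 : ℝ) (((hasDerivAt_id (0 : ℝ)).const_mul t).div_const 2)).const_mul 2
      refine h3.congr_deriv ?_
      ring
    have h2 := hasDerivAt_iff_tendsto_slope_zero.1 h1
    have h3 : Tendsto (fun n : ℕ => ((n : ℝ))⁻¹) atTop (𝓝[≠] 0) := by
      refine tendsto_nhdsWithin_iff.2 ⟨tendsto_inv_atTop_nhds_zero_nat, ?_⟩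
      filter_upwards [eventually_gt_atTop 0] with n hn
      have : (n : ℝ) ≠ 0 := by positivity
      simpa using hn.ne'
    refine (h2.comp h3).congr fun n => ?_
    simp [div_eq_mul_inv]
  refine ge_of_tendsto hlim ?_
  filter_upwards [eventually_gt_atTop 0] with n hn'
  have h1 := hn n (t / n) (by positivity)
  have : (n : ℝ) ≠ 0 := by positivity
  rwa [show (n : ℝ) * (t / n) = t by field_simp] at h1

/-- A smooth map of the sphere which does not increase lengths does not increase distances. -/
theorem angle_map_le {f : S2 → S2} (hf : ContMDiff (𝓡 2) (𝓡 2) ∞ f)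
    (hd : ∀ (q : S2) (u : TangentSpace (𝓡 2) q),
      ‖dIncl (f q) (mfderiv (𝓡 2) (𝓡 2) f q u)‖ ≤ ‖dIncl q u‖) (x y : S2) :
    angle (f x : E3) (f y) ≤ angle (x : E3) y := by
  set θ := angle (x : E3) y with hθ
  have hcos : ⟪(x : E3), y⟫_ℝ = Real.cos θ := by
    rw [← cos_angle_mul_norm_mul_norm, norm_coe_S2, norm_coe_S2, ← hθ]; ring
  have hn : ‖(y : E3) - Real.cos θ • (x : E3)‖ = Real.sin θ := by
    have h0 : 0 ≤ Real.sin θ := Real.sin_nonneg_of_nonneg_of_le_pi (angle_nonneg _ _)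
      (angle_le_pi _ _)
    refine (sq_eq_sq₀ (norm_nonneg _) h0).1 ?_
    rw [norm_sub_sq_real, real_inner_smul_right, real_inner_comm, hcos, norm_smul, norm_coe_S2,
      norm_coe_S2, Real.sin_sq, Real.norm_eq_abs, mul_one, sq_abs]
    ring
  by_cases hs : Real.sin θ = 0
  -- No unique great circle joins x to y here: either x = y, or they are antipodal and θ = π bounds
  -- every angle.
  · rw [hs, norm_eq_zero, sub_eq_zero] at hn
    rcases Real.sin_eq_zero_iff_cos_eq.1 hs with h1 | h1
    · rw [h1, one_smul] at hn
      rw [Subtype.ext hn, angle_self (coe_S2_ne_zero _)]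
      exact angle_nonneg _ _
    · have h2 : θ = Real.pi := by
        rw [hθ, ← Real.arccos_cos (angle_nonneg (x : E3) y) (angle_le_pi _ _), ← hθ, h1,
          Real.arccos_neg_one]
      rw [h2]
      exact angle_le_pi _ _
  · set e : E3 := (Real.sin θ)⁻¹ • ((y : E3) - Real.cos θ • (x : E3)) with he
    have hen : ‖e‖ = 1 := by
      rw [he, norm_smul, hn, Real.norm_eq_abs, abs_of_nonneg, inv_mul_cancel₀ hs]
      rw [← hn]; positivity
    have hex : ⟪(x : E3), e⟫_ℝ = 0 := by
      rw [he, real_inner_smul_right, inner_sub_right, real_inner_smul_right, inner_self_S2, hcos]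
      ring
    -- The unit-speed great circle from x to y, reached at time θ; its image under f is 1-Lipschitz.
    set g : ℝ → E3 := fun t => Real.cos t • (x : E3) + Real.sin t • e with hg
    have hgn (t : ℝ) : ‖g t‖ = 1 := by
      refine (sq_eq_sq₀ (norm_nonneg _) zero_le_one).1 ?_
      rw [hg]; simp only
      rw [norm_add_sq_real, real_inner_smul_left, real_inner_smul_right, hex, norm_smul, norm_smul,
        hen, norm_coe_S2]
      simp
    let γ : ℝ → S2 := fun t => ⟨g t, by simp [hgn]⟩
    have hgd (t : ℝ) : HasDerivAt g (-Real.sin t • (x : E3) + Real.cos t • e) t :=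
      ((Real.hasDerivAt_cos t).smul_const _).add ((Real.hasDerivAt_sin t).smul_const _)
    have hgs : ContDiff ℝ ∞ g :=
      (Real.contDiff_cos.smul contDiff_const).add (Real.contDiff_sin.smul contDiff_const)
    have hγ : ContMDiff 𝓘(ℝ, ℝ) (𝓡 2) ∞ γ := fun t =>
      contMDiffWithinAt_of_coe_S2 (f := γ) hgs.contMDiff.contMDiffAt
    have hgd1 (t : ℝ) : ‖-Real.sin t • (x : E3) + Real.cos t • e‖ = 1 := by
      refine (sq_eq_sq₀ (norm_nonneg _) zero_le_one).1 ?_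
      rw [norm_add_sq_real, real_inner_smul_left, real_inner_smul_right, hex, norm_smul, norm_smul,
        hen, norm_coe_S2]
      simp
    let c : ℝ → E3 := fun t => f (γ t)
    have hγd (t : ℝ) : dIncl (γ t) (mfderiv 𝓘(ℝ, ℝ) (𝓡 2) γ t (1 : ℝ))
        = -Real.sin t • (x : E3) + Real.cos t • e := by
      have h1 := (mdifferentiableAt_coe_S2 (γ t)).hasMFDerivAt.comp t
        (hγ.mdifferentiableAt (by simp)).hasMFDerivAt
      have h2 := hasMFDerivAt_unique h1 (hgd t).hasFDerivAt.hasMFDerivAt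
      have h3 := congrArg (fun L => L (1 : ℝ)) h2
      exact h3.trans (one_smul ℝ _)
    have hcd (t : ℝ) : HasDerivAt c (dIncl (f (γ t)) (mfderiv (𝓡 2) (𝓡 2) f (γ t)
        (mfderiv 𝓘(ℝ, ℝ) (𝓡 2) γ t (1 : ℝ)))) t := by
      have h1 : HasMFDerivAt 𝓘(ℝ, ℝ) 𝓘(ℝ, E3) c t _ :=
        (mdifferentiableAt_coe_S2 (f (γ t))).hasMFDerivAt.comp t
        ((hf.mdifferentiableAt (by simp)).hasMFDerivAt.comp t
        (hγ.mdifferentiableAt (by simp)).hasMFDerivAt)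
      have h2 : deriv c t = dIncl (f (γ t)) (mfderiv (𝓡 2) (𝓡 2) f (γ t)
          (mfderiv 𝓘(ℝ, ℝ) (𝓡 2) γ t (1 : ℝ))) := by
        rw [← fderiv_apply_one_eq_deriv, ← mfderiv_eq_fderiv]
        exact congrArg (fun L => L (1 : ℝ)) h1.mfderiv
      rw [← h2]
      exact h1.mdifferentiableAt.differentiableAt.hasDerivAt
    have hLip (s t : ℝ) : ‖c s - c t‖ ≤ |s - t| := by
      have := Convex.norm_image_sub_le_of_norm_hasDerivWithin_le (f := c) (C := 1) (x := t) (y := s)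
        (s := Set.univ) (fun t _ => (hcd t).hasDerivWithinAt)
        (fun t _ => (hd _ _).trans (by rw [hγd, hgd1])) convex_univ trivial trivial
      simpa using this
    have h0 : γ 0 = x := Subtype.ext (by simp [γ, hg])
    have h1 : γ θ = y := Subtype.ext (by simp [γ, hg, he, smul_smul, mul_inv_cancel₀ hs])
    have := angle_le_of_lipschitz (c := c) (fun t => norm_coe_S2 _) hLip (angle_nonneg (x : E3) y)
    simpa only [c, h0, ← hθ, h1] using this

variable {o : Orientation ℝ E3 (Fin 3)} {F : S2 ≃ₘ⟮𝓡 2, 𝓡 2⟯ S2}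

theorem IsOrientedIsometry.norm_dIncl (hF : IsOrientedIsometry o F) (q : S2)
    (u : TangentSpace (𝓡 2) q) :
    ‖dIncl (F q) (mfderiv (𝓡 2) (𝓡 2) F q u)‖ = ‖dIncl q u‖ := by
  have h := hF.metric q u u
  rw [roundMetric, roundMetric, real_inner_self_eq_norm_sq, real_inner_self_eq_norm_sq] at h
  exact (sq_eq_sq₀ (norm_nonneg _) (norm_nonneg _)).1 h

theorem IsOrientedIsometry.angle_eq (hF : IsOrientedIsometry o F) (x y : S2) :
    angle (F x : E3) (F y) = angle (x : E3) y := by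
  refine le_antisymm (angle_map_le F.contMDiff (fun q u => (hF.norm_dIncl q u).le) x y) ?_
  -- The reverse inequality is the distance bound for F⁻¹, which preserves lengths by the chain rule
  -- for F ∘ F⁻¹.
  have hd (q : S2) (u : TangentSpace (𝓡 2) q) :
      ‖dIncl (F.symm q) (mfderiv (𝓡 2) (𝓡 2) F.symm q u)‖ ≤ ‖dIncl q u‖ := by
    rw [← hF.norm_dIncl]
    have h1 := ((F.contMDiff.mdifferentiableAt (by simp)).hasMFDerivAt (x := F.symm q)).comp q
      (F.symm.contMDiff.mdifferentiableAt (by simp)).hasMFDerivAt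
    have h2 : HasMFDerivAt (𝓡 2) 𝓘(ℝ, E3) (Subtype.val ∘ F ∘ F.symm) q _ :=
      (mdifferentiableAt_coe_S2 (F (F.symm q))).hasMFDerivAt.comp q h1
    have h3 : (Subtype.val ∘ F ∘ F.symm : S2 → E3) = Subtype.val := by ext1; simp
    rw [h3] at h2
    have h4 := hasMFDerivAt_unique h2 (mdifferentiableAt_coe_S2 q).hasMFDerivAt
    have h5 : dIncl (F (F.symm q)) (mfderiv (𝓡 2) (𝓡 2) F (F.symm q)
        (mfderiv (𝓡 2) (𝓡 2) F.symm q u)) = dIncl q u := congrArg (fun L => L u) h4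
    rw [h5]
  have := angle_map_le F.symm.contMDiff hd (F x) (F y)
  simpa using this

theorem IsOrientedIsometry.inner_eq (hF : IsOrientedIsometry o F) (x y : S2) :
    ⟪(F x : E3), F y⟫_ℝ = ⟪(x : E3), y⟫_ℝ := by
  rw [← cos_angle_mul_norm_mul_norm, ← cos_angle_mul_norm_mul_norm, hF.angle_eq]
  simp only [norm_coe_S2]

/-- An isometry of the round sphere is the restriction of a linear isometry. -/
theorem IsOrientedIsometry.exists_linear (hF : IsOrientedIsometry o F) :
    ∃ A : E3 ≃ₗᵢ[ℝ] E3, ∀ q : S2, (F q : E3) = A q := by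
  let b := EuclideanSpace.basisFun (Fin 3) ℝ
  let bS : Fin 3 → S2 := fun i => ⟨b i, by simp [b]⟩
  have ho : Orthonormal ℝ (fun i => (F (bS i) : E3)) := by
    rw [orthonormal_iff_ite]
    intro i j
    rw [hF.inner_eq]
    exact orthonormal_iff_ite.1 b.orthonormal i j
  have hspan := ho.linearIndependent.span_eq_top_of_card_eq_finrank (by simp)
  let b' : OrthonormalBasis (Fin 3) ℝ E3 := OrthonormalBasis.mk ho hspan.ge
  refine ⟨b.equiv b' (Equiv.refl _), fun q => ?_⟩
  have h1 : (F q : E3) = ∑ i, ⟪b' i, F q⟫_ℝ • b' i := (b'.sum_repr' _).symm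
  have h2 : (q : E3) = ∑ i, ⟪b i, q⟫_ℝ • b i := (b.sum_repr' _).symm
  rw [h1]
  conv_rhs => rw [h2]
  rw [map_sum]
  refine Finset.sum_congr rfl fun i _ => ?_
  rw [map_smul, OrthonormalBasis.equiv_apply_basis]
  have h3 : b' i = F (bS i) := by simp [b']
  rw [Equiv.refl_apply, h3, hF.inner_eq]

theorem dIncl_mfderiv_eq {A : E3 ≃ₗᵢ[ℝ] E3} (hA : ∀ q : S2, (F q : E3) = A q) (q : S2)
    (u : TangentSpace (𝓡 2) q) :
    dIncl (F q) (mfderiv (𝓡 2) (𝓡 2) F q u) = A (dIncl q u) := by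
  have h1 : HasMFDerivAt (𝓡 2) 𝓘(ℝ, E3) (fun q => (F q : E3)) q _ :=
    (mdifferentiableAt_coe_S2 (F q)).hasMFDerivAt.comp q
      (F.contMDiff.mdifferentiableAt (by simp)).hasMFDerivAt
  have h2 : HasMFDerivAt (𝓡 2) 𝓘(ℝ, E3) (fun q : S2 => A (q : E3)) q _ :=
    (A.toContinuousLinearEquiv.hasFDerivAt (x := (q : E3))).hasMFDerivAt.comp q
      (mdifferentiableAt_coe_S2 q).hasMFDerivAt
  rw [show (fun q => (F q : E3)) = fun q : S2 => A (q : E3) from funext hA] at h1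
  exact congrArg (fun L => L u) (hasMFDerivAt_unique h1 h2)

/-- It suffices to test distinct basis vectors. The first is then a point of the sphere and the
other two are tangent there, so preservation of the area form applies. -/
theorem IsOrientedIsometry.volE3_eq (hF : IsOrientedIsometry o F) {A : E3 ≃ₗᵢ[ℝ] E3}
    (hA : ∀ q : S2, (F q : E3) = A q) (u v w : E3) :
    volE3 o ![A u, A v, A w] = volE3 o ![u, v, w] := by
  let b := EuclideanSpace.basisFun (Fin 3) ℝ
  have h : (volE3 o).toAlternatingMap.compLinearMap A.toLinearEquiv.toLinearMap
      = (volE3 o).toAlternatingMap := by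
    refine b.toBasis.ext_alternating fun i hi => ?_
    let q : S2 := ⟨b (i 0), by simp [b]⟩
    have hq (j : Fin 3) (hj : 0 ≠ j) : ⟪(q : E3), b (i j)⟫_ℝ = 0 :=
      b.orthonormal.2 (hi.ne hj)
    have h1 := congrFun hF.area q
    have h2 := congrArg (fun L => L ![tangentProj q (b (i 1)), tangentProj q (b (i 2))]) h1
    have h3 : volE3 o ![(F q : E3),
        dIncl (F q) (mfderiv (𝓡 2) (𝓡 2) F q (tangentProj q (b (i 1)))),
        dIncl (F q) (mfderiv (𝓡 2) (𝓡 2) F q (tangentProj q (b (i 2))))]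
        = volE3 o ![(q : E3), dIncl q (tangentProj q (b (i 1))),
          dIncl q (tangentProj q (b (i 2)))] := by
      convert h2 using 1
      · change _ = volE3 o (Matrix.vecCons _ _)
        congr 2
        ext j; fin_cases j <;> rfl
      · change _ = volE3 o (Matrix.vecCons _ _)
        congr 2
        ext j; fin_cases j <;> rfl
    rw [dIncl_mfderiv_eq hA, dIncl_mfderiv_eq hA,
      dIncl_tangentProj_of_inner_eq_zero (hq 1 (by decide)),
      dIncl_tangentProj_of_inner_eq_zero (hq 2 (by decide)), hA] at h3
    change volE3 o (fun j => A (b.toBasis (i j))) = volE3 o (fun j => b.toBasis (i j))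
    convert h3 using 2
    · ext j; fin_cases j <;> simp [q]
    · ext j; fin_cases j <;> simp [q]
  have h1 := congrArg (fun L => L ![u, v, w]) h
  refine Eq.trans ?_ h1
  change _ = volE3 o (fun j => A (![u, v, w] j))
  congr 1
  ext j; fin_cases j <;> rfl

theorem IsOrientedIsometry.cross_eq (hF : IsOrientedIsometry o F) {A : E3 ≃ₗᵢ[ℝ] E3}
    (hA : ∀ q : S2, (F q : E3) = A q) (u v : E3) : cross o (A u) (A v) = A (cross o u v) := by
  refine ext_inner_right ℝ fun w => ?_
  obtain ⟨w, rfl⟩ := A.surjective w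
  rw [A.inner_map_map, inner_cross, inner_cross, hF.volE3_eq hA]

theorem covec_eq_of_inner {x : CotangentS2} {w : E3} (h0 : ⟪(x.1 : E3), w⟫_ℝ = 0)
    (h : ∀ u : TangentSpace (𝓡 2) x.1, ⟪w, dIncl x.1 u⟫_ℝ = x.2 u) : covec x = w := by
  refine ext_inner_right ℝ fun a => ?_
  rw [inner_covec, ← h, dIncl_tangentProj, inner_sub_right, real_inner_smul_right,
    real_inner_comm (x.1 : E3) w, h0]
  ring

theorem covec_cotangentLift {A : E3 ≃ₗᵢ[ℝ] E3} (hA : ∀ q : S2, (F q : E3) = A q)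
    (x : CotangentS2) : covec (cotangentLift F x) = A (covec x) := by
  refine covec_eq_of_inner ?_ fun u => ?_
  · change ⟪(F x.1 : E3), A (covec x)⟫_ℝ = 0
    rw [hA, A.inner_map_map, inner_coe_covec]
  · change TangentSpace (𝓡 2) (F x.1) at u
    set L := F.mfderivToContinuousLinearEquiv (by simp) x.1 with hL
    change ⟪A (covec x), dIncl (F x.1) u⟫_ℝ = x.2 (L.symm u)
    have h1 : mfderiv (𝓡 2) (𝓡 2) F x.1 (L.symm u) = u := L.apply_symm_apply u
    rw [← inner_covec_dIncl, ← A.inner_map_map (covec x), ← dIncl_mfderiv_eq hA, h1]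

theorem emb_cotangentLift {A : E3 ≃ₗᵢ[ℝ] E3} (hA : ∀ q : S2, (F q : E3) = A q)
    (x : CotangentS2) : emb (cotangentLift F x) = (A (emb x).1, A (emb x).2) :=
  Prod.ext (hA x.1) (covec_cotangentLift hA x)

end Isometries

/-! ### The family of symplectomorphisms -/

variable (o : Orientation ℝ E3 (Fin 3))

/-- The cosine of the rotation angle. -/
def cosCoeff (s : ℝ) (v : E3) : ℝ := √(‖v‖ ^ 2 - s ^ 2) / ‖v‖

/-- The sine of the rotation angle, divided by `‖v‖`. -/
def sinCoeff (s : ℝ) (v : E3) : ℝ := s / ‖v‖ ^ 2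

/-- The map `(q, v) ↦ (c q + k q × v, c v)` of `E3 × E3`: it rotates `q` about the axis `v` by an
angle with sine `s / ‖v‖` and rescales `v` to length `√(‖v‖² - s²)`. -/
def twist (s : ℝ) (z : E3 × E3) : E3 × E3 :=
  (cosCoeff s z.2 • z.1 + sinCoeff s z.2 • cross o z.1 z.2, cosCoeff s z.2 • z.2)

/-- The inverse of `twist`. -/
def untwist (s : ℝ) (z : E3 × E3) : E3 × E3 :=
  ((‖z.2‖ / √(‖z.2‖ ^ 2 + s ^ 2)) • z.1
      - (s / (√(‖z.2‖ ^ 2 + s ^ 2) * ‖z.2‖)) • cross o z.1 z.2,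
    (√(‖z.2‖ ^ 2 + s ^ 2) / ‖z.2‖) • z.2)

/-- The map of `T^*S²` induced by `twist`. -/
def twistCot (s : ℝ) (x : CotangentS2) : CotangentS2 := retr (twist o s (emb x))

/-- The map of `T^*S²` induced by `untwist`. -/
def untwistCot (s : ℝ) (x : CotangentS2) : CotangentS2 := retr (untwist o s (emb x))

theorem cosCoeff_sq_mul {s : ℝ} {v : E3} (hv : v ≠ 0) (hs : s ^ 2 ≤ ‖v‖ ^ 2) :
    cosCoeff s v ^ 2 * ‖v‖ ^ 2 = ‖v‖ ^ 2 - s ^ 2 := by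
  have : ‖v‖ ≠ 0 := by simpa using hv
  rw [cosCoeff, div_pow, Real.sq_sqrt (by linarith)]
  field_simp

theorem sinCoeff_mul {s : ℝ} {v : E3} (hv : v ≠ 0) : sinCoeff s v * ‖v‖ ^ 2 = s := by
  have : ‖v‖ ≠ 0 := by simpa using hv
  rw [sinCoeff]
  field_simp

theorem cosCoeff_sq_add {s : ℝ} {v : E3} (hv : v ≠ 0) (hs : s ^ 2 ≤ ‖v‖ ^ 2) :
    cosCoeff s v ^ 2 + sinCoeff s v ^ 2 * ‖v‖ ^ 2 = 1 := by
  have h0 : ‖v‖ ^ 2 ≠ 0 := by simpa using hv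
  have h1 := cosCoeff_sq_mul hv hs
  have h2 := sinCoeff_mul (s := s) hv
  refine mul_right_cancel₀ h0 ?_
  linear_combination h1 + (sinCoeff s v * ‖v‖ ^ 2 + s) * h2

variable {o}

theorem norm_rotate {q v : E3} (hq : ‖q‖ = 1) (hv : ⟪q, v⟫_ℝ = 0) {c k : ℝ}
    (h : c ^ 2 + k ^ 2 * ‖v‖ ^ 2 = 1) : ‖c • q + k • cross o q v‖ = 1 := by
  have hq' : ⟪q, q⟫_ℝ = 1 := by rw [real_inner_self_eq_norm_sq, hq]; norm_num
  have h1 := inner_frame o hq' hv c 0 k c 0 k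
  rw [show c • q + (0 : ℝ) • v + k • cross o q v = c • q + k • cross o q v by module,
    real_inner_self_eq_norm_sq, real_inner_self_eq_norm_sq] at h1
  refine (sq_eq_sq₀ (norm_nonneg _) zero_le_one).1 ?_
  rw [h1]
  linarith

theorem inner_rotate {q v : E3} (hv : ⟪q, v⟫_ℝ = 0) (c k : ℝ) :
    ⟪c • q + k • cross o q v, v⟫_ℝ = 0 := by
  rw [inner_add_left, real_inner_smul_left, real_inner_smul_left, hv, real_inner_comm,
    inner_cross_right]
  ring

/-- Gives the cross product of the turned point with v, needed to compose `twist` and `untwist`. -/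
theorem cross_rotate {q v : E3} (hv : ⟪q, v⟫_ℝ = 0) (c k : ℝ) :
    cross o (c • q + k • cross o q v) v = c • cross o q v - (k * ‖v‖ ^ 2) • q := by
  have h1 : cross o (cross o q v) v = -(‖v‖ ^ 2 • q) := by
    rw [cross_swap, cross_cross, real_inner_comm q v, hv, real_inner_self_eq_norm_sq]; module
  rw [map_add, map_smul, map_smul, add_apply, smul_apply, smul_apply, h1]
  module

theorem norm_cosCoeff_smul {s : ℝ} {v : E3} (hv : v ≠ 0) :
    ‖cosCoeff s v • v‖ = √(‖v‖ ^ 2 - s ^ 2) := by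
  have : ‖v‖ ≠ 0 := by simpa using hv
  rw [norm_smul, cosCoeff, Real.norm_eq_abs, abs_of_nonneg (by positivity)]
  field_simp

/-- `twist` preserves |q| = 1 and q ⊥ v because it turns q in the plane orthogonal to v. The
equality s = |v| is allowed, for use on the boundary. -/
theorem emb_twistCot {s : ℝ} {x : CotangentS2} (hx : covec x ≠ 0) (hs : s ^ 2 ≤ ‖covec x‖ ^ 2) :
    emb (twistCot o s x) = twist o s (emb x) := by
  refine emb_retr (norm_rotate (norm_coe_S2 x.1) (inner_coe_covec x) (cosCoeff_sq_add hx hs)) ?_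
  exact (real_inner_smul_right _ _ _).trans
    (by rw [emb, inner_rotate (inner_coe_covec x), mul_zero])

theorem covec_twistCot {s : ℝ} {x : CotangentS2} (hx : covec x ≠ 0)
    (hs : s ^ 2 ≤ ‖covec x‖ ^ 2) : covec (twistCot o s x) = cosCoeff s (covec x) • covec x :=
  congrArg Prod.snd (emb_twistCot (o := o) hx hs)

theorem conorm_twistCot {s : ℝ} {x : CotangentS2} (hx : covec x ≠ 0)
    (hs : s ^ 2 ≤ ‖covec x‖ ^ 2) : conorm (twistCot o s x) = √(conorm x ^ 2 - s ^ 2) := by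
  rw [conorm_eq, conorm_eq, covec_twistCot hx hs, norm_cosCoeff_smul hx]

theorem untwist_coeff (s : ℝ) {v : E3} (hv : v ≠ 0) :
    (‖v‖ / √(‖v‖ ^ 2 + s ^ 2)) ^ 2 + (-(s / (√(‖v‖ ^ 2 + s ^ 2) * ‖v‖))) ^ 2 * ‖v‖ ^ 2 = 1 := by
  have h0 : 0 < ‖v‖ := by simpa using hv
  have h1 : 0 < ‖v‖ ^ 2 + s ^ 2 := by positivity
  have h2 := Real.sq_sqrt h1.le
  have h3 : 0 < √(‖v‖ ^ 2 + s ^ 2) := Real.sqrt_pos.2 h1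
  field_simp
  rw [h2]

theorem untwist_fst (s : ℝ) (q v : E3) : (untwist o s (q, v)).1
    = (‖v‖ / √(‖v‖ ^ 2 + s ^ 2)) • q
      + (-(s / (√(‖v‖ ^ 2 + s ^ 2) * ‖v‖))) • cross o q v := by
  simp only [untwist]; module

theorem emb_untwistCot (s : ℝ) {x : CotangentS2} (hx : covec x ≠ 0) :
    emb (untwistCot o s x) = untwist o s (emb x) := by
  have h := untwist_fst (o := o) s x.1 (covec x)
  refine emb_retr ?_ ?_
  · change ‖(untwist o s ((x.1 : E3), covec x)).1‖ = 1
    rw [h]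
    exact norm_rotate (norm_coe_S2 x.1) (inner_coe_covec x) (untwist_coeff s hx)
  · change ⟪(untwist o s ((x.1 : E3), covec x)).1, _ • covec x⟫_ℝ = 0
    rw [h, real_inner_smul_right, inner_rotate (inner_coe_covec x), mul_zero]

theorem norm_untwist_snd (s : ℝ) {q v : E3} (hv : v ≠ 0) :
    ‖(untwist o s (q, v)).2‖ = √(‖v‖ ^ 2 + s ^ 2) := by
  have : ‖v‖ ≠ 0 := by simpa using hv
  simp only [untwist]
  rw [norm_smul, Real.norm_eq_abs, abs_of_nonneg (by positivity)]
  field_simp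

theorem conorm_untwistCot (s : ℝ) {x : CotangentS2} (hx : covec x ≠ 0) :
    conorm (untwistCot o s x) = √(conorm x ^ 2 + s ^ 2) := by
  have h : covec (untwistCot o s x) = (untwist o s ((x.1 : E3), covec x)).2 :=
    congrArg Prod.snd (emb_untwistCot (o := o) s hx)
  rw [conorm_eq, conorm_eq, h, norm_untwist_snd s hx]

theorem untwist_twist {s : ℝ} {q v : E3} (hv : ⟪q, v⟫_ℝ = 0) (hv0 : v ≠ 0)
    (hs : s ^ 2 < ‖v‖ ^ 2) : untwist o s (twist o s (q, v)) = (q, v) := by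
  have h0 : 0 < ‖v‖ := by simpa using hv0
  have hR : 0 < √(‖v‖ ^ 2 - s ^ 2) := Real.sqrt_pos.2 (by linarith)
  have hc : 0 < cosCoeff s v := div_pos hR h0
  have hck := cosCoeff_sq_add hv0 hs.le
  have hn : ‖cosCoeff s v • v‖ = cosCoeff s v * ‖v‖ := by
    rw [norm_smul, Real.norm_eq_abs, abs_of_pos hc]
  have hsq : √((cosCoeff s v * ‖v‖) ^ 2 + s ^ 2) = ‖v‖ := by
    rw [mul_pow, cosCoeff_sq_mul hv0 hs.le, sub_add_cancel, Real.sqrt_sq h0.le]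
  have hk : sinCoeff s v = s / ‖v‖ ^ 2 := rfl
  simp only [twist, untwist]
  rw [hn, hsq, map_smul, cross_rotate hv]
  generalize cosCoeff s v = c at *
  have e1 : c * ‖v‖ / ‖v‖ = c := by field_simp
  -- The inverse turns by the opposite angle, but its cross product is with c v rather than v; hence
  -- the coefficient k / c.
  have e2 : s / (‖v‖ * (c * ‖v‖)) = sinCoeff s v / c := by rw [hk]; field_simp
  have e3 : ‖v‖ / (c * ‖v‖) = c⁻¹ := by field_simp
  rw [e1, e2, e3, smul_smul, smul_smul, div_mul_cancel₀ _ hc.ne', inv_mul_cancel₀ hc.ne', one_smul]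
  refine Prod.ext ?_ rfl
  linear_combination (norm := module) hck • q

theorem twist_untwist {s : ℝ} {q v : E3} (hv : ⟪q, v⟫_ℝ = 0) (hv0 : v ≠ 0) :
    twist o s (untwist o s (q, v)) = (q, v) := by
  have h0 : 0 < ‖v‖ := by simpa using hv0
  have h1 : 0 < ‖v‖ ^ 2 + s ^ 2 := by positivity
  have h2 := Real.sq_sqrt h1.le
  have hn := norm_untwist_snd (o := o) (q := q) s hv0
  have hck := untwist_coeff s hv0
  have hf := untwist_fst (o := o) s q v
  have hsnd : (untwist o s (q, v)).2 = (√(‖v‖ ^ 2 + s ^ 2) / ‖v‖) • v := rfl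
  have hR : 0 < √(‖v‖ ^ 2 + s ^ 2) := Real.sqrt_pos.2 h1
  rw [twist, cosCoeff, sinCoeff, hn, show √(√(‖v‖ ^ 2 + s ^ 2) ^ 2 - s ^ 2) = ‖v‖ by
    rw [h2, add_sub_cancel_right, Real.sqrt_sq h0.le], hf, hsnd, map_smul, cross_rotate hv]
  generalize √(‖v‖ ^ 2 + s ^ 2) = R at *
  refine Prod.ext ?_ ?_
  · have e1 : s / R ^ 2 * (R / ‖v‖) * (‖v‖ / R) = ‖v‖ / R * (s / (R * ‖v‖)) := by field_simp
    have e2 : s / R ^ 2 * (R / ‖v‖) * (s / (R * ‖v‖)) = (s / (R * ‖v‖)) ^ 2 := by field_simp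
    linear_combination (norm := module) hck • q + e1 • cross o q v + (‖v‖ ^ 2 * e2) • q
  · simp only [smul_smul]
    rw [show ‖v‖ / R * (R / ‖v‖) = 1 by field_simp, one_smul]

/-! ### Smoothness -/

variable (o)

theorem contDiffAt_cross {E : Type*} [NormedAddCommGroup E] [NormedSpace ℝ E] {f g : E → E3} {x : E}
    (hf : ContDiffAt ℝ ∞ f x) (hg : ContDiffAt ℝ ∞ g x) :
    ContDiffAt ℝ ∞ (fun y => cross o (f y) (g y)) x :=
  ((cross o).contDiff.contDiffAt.comp x hf).clm_apply hg

theorem contDiffAt_twist {y : ℝ × (E3 × E3)} (hv : y.2.2 ≠ 0) (hs : y.1 ^ 2 < ‖y.2.2‖ ^ 2) :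
    ContDiffAt ℝ ∞ (fun y : ℝ × (E3 × E3) => twist o y.1 y.2) y := by
  have hq : ContDiffAt ℝ ∞ (fun y : ℝ × (E3 × E3) => y.2.1) y := by fun_prop
  have hp : ContDiffAt ℝ ∞ (fun y : ℝ × (E3 × E3) => y.2.2) y := by fun_prop
  have hn : ContDiffAt ℝ ∞ (fun y : ℝ × (E3 × E3) => ‖y.2.2‖) y := hp.norm ℝ hv
  have h0 : ‖y.2.2‖ ≠ 0 := by simpa using hv
  have hc : ContDiffAt ℝ ∞ (fun y : ℝ × (E3 × E3) => cosCoeff y.1 y.2.2) y :=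
    (((hn.pow 2).sub (contDiffAt_fst.pow 2)).sqrt (by linarith)).div hn h0
  have hk : ContDiffAt ℝ ∞ (fun y : ℝ × (E3 × E3) => sinCoeff y.1 y.2.2) y :=
    contDiffAt_fst.div (hn.pow 2) (pow_ne_zero 2 h0)
  exact ((hc.smul hq).add (hk.smul (contDiffAt_cross o hq hp))).prodMk (hc.smul hp)

theorem contDiffAt_untwist (s : ℝ) {z : E3 × E3} (hv : z.2 ≠ 0) :
    ContDiffAt ℝ ∞ (untwist o s) z := by
  have hq : ContDiffAt ℝ ∞ (fun z : E3 × E3 => z.1) z := contDiffAt_fst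
  have hp : ContDiffAt ℝ ∞ (fun z : E3 × E3 => z.2) z := contDiffAt_snd
  have hn : ContDiffAt ℝ ∞ (fun z : E3 × E3 => ‖z.2‖) z := hp.norm ℝ hv
  have h0 : 0 < ‖z.2‖ := by simpa using hv
  have hR : ContDiffAt ℝ ∞ (fun z : E3 × E3 => √(‖z.2‖ ^ 2 + s ^ 2)) z :=
    ((hn.pow 2).add contDiffAt_const).sqrt (by positivity)
  have hR0 : √(‖z.2‖ ^ 2 + s ^ 2) ≠ 0 := (Real.sqrt_pos.2 (by positivity)).ne'
  exact (((hn.div hR hR0).smul hq).sub ((contDiffAt_const.div (hR.mul hn)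
    (mul_ne_zero hR0 h0.ne')).smul (contDiffAt_cross o hq hp))).prodMk
      ((hR.div hn h0.ne').smul hp)

theorem twist_fst_ne_zero {s : ℝ} {x : CotangentS2} (hx : covec x ≠ 0)
    (hs : s ^ 2 ≤ ‖covec x‖ ^ 2) : (twist o s (emb x)).1 ≠ 0 := by
  rw [← emb_twistCot hx hs]; exact coe_S2_ne_zero _

theorem contMDiffAt_twistCot_uncurry {y : ℝ × CotangentS2} (hx : covec y.2 ≠ 0)
    (hs : y.1 ^ 2 < ‖covec y.2‖ ^ 2) :
    ContMDiffAt (𝓘(ℝ, ℝ).prod ICot) ICot ∞ (fun y : ℝ × CotangentS2 => twistCot o y.1 y.2) y := by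
  have h1 : ContMDiffAt (𝓘(ℝ, ℝ).prod ICot) 𝓘(ℝ, ℝ × (E3 × E3)) ∞
      (fun y : ℝ × CotangentS2 => (y.1, emb y.2)) y :=
    contMDiffAt_fst.prodMk_space ((contMDiff_emb _).comp y contMDiffAt_snd)
  have h2 := (contDiffAt_twist o (y := (y.1, emb y.2)) hx hs).contMDiffAt.comp y h1
  exact (contMDiffAt_retr (twist_fst_ne_zero o hx hs.le)).comp y h2

theorem contMDiffAt_twistCot {s : ℝ} {x : CotangentS2} (hx : covec x ≠ 0)
    (hs : s ^ 2 < ‖covec x‖ ^ 2) : ContMDiffAt ICot ICot ∞ (twistCot o s) x :=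
  (contMDiffAt_twistCot_uncurry o (y := (s, x)) hx hs).comp x
    (contMDiffAt_const.prodMk contMDiffAt_id)

theorem contMDiffAt_untwistCot (s : ℝ) {x : CotangentS2} (hx : covec x ≠ 0) :
    ContMDiffAt ICot ICot ∞ (untwistCot o s) x := by
  have h2 := (contDiffAt_untwist o s (z := emb x) hx).contMDiffAt.comp x (contMDiff_emb x)
  refine (contMDiffAt_retr ?_).comp x h2
  rw [← emb_untwistCot s hx]; exact coe_S2_ne_zero _

/-- At |v| = s the square root is continuous but not smooth. Nearby points with |v| < s cause no
trouble: there `Real.sqrt` is 0, and `retr` is continuous wherever the first component is nonzero.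
-/
theorem continuousAt_twistCot {s : ℝ} {x : CotangentS2} (hx : covec x ≠ 0)
    (hs : s ^ 2 ≤ ‖covec x‖ ^ 2) : ContinuousAt (twistCot o s) x := by
  have h0 : ‖(emb x).2‖ ≠ 0 := norm_ne_zero_iff.2 hx
  have hn : ContinuousAt (fun z : E3 × E3 => ‖z.2‖) (emb x) := by fun_prop
  have hc : ContinuousAt (fun z : E3 × E3 => cosCoeff s z.2) (emb x) :=
    ((hn.pow 2).sub continuousAt_const).sqrt.div hn h0
  have hk : ContinuousAt (fun z : E3 × E3 => sinCoeff s z.2) (emb x) :=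
    continuousAt_const.div (hn.pow 2) (pow_ne_zero 2 h0)
  have hcr : ContinuousAt (fun z : E3 × E3 => cross o z.1 z.2) (emb x) :=
    (contDiffAt_cross o contDiffAt_fst contDiffAt_snd).continuousAt
  have ht : ContinuousAt (twist o s) (emb x) :=
    ((hc.smul continuousAt_fst).add (hk.smul hcr)).prodMk (hc.smul continuousAt_snd)
  exact ContinuousAt.comp (f := twist o s ∘ emb)
    (contMDiffAt_retr (twist_fst_ne_zero o hx hs)).continuousAt
    (ContinuousAt.comp (f := emb) ht contMDiff_emb.continuous.continuousAt)

theorem continuous_conorm : Continuous conorm := by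
  rw [show conorm = fun x => ‖covec x‖ from funext conorm_eq]
  exact contMDiff_covec.continuous.norm

/-! ### The symplectic forms -/

/-- The increments dc, dk are not computed explicitly: differentiating c²|v|² = |v|² - s² and k|v|²
= s gives exactly the relations that `twist_identity` consumes. -/
theorem exists_fderiv_twist {s : ℝ} {z : E3 × E3} (hv : z.2 ≠ 0) (hs : s ^ 2 < ‖z.2‖ ^ 2) :
    ∃ dc dk : E3 × E3 → ℝ,
      (∀ ξ, cosCoeff s z.2 * dc ξ = sinCoeff s z.2 ^ 2 * ⟪z.2, ξ.2⟫_ℝ) ∧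
      (∀ ξ, dk ξ * ⟪z.2, z.2⟫_ℝ = -(2 * sinCoeff s z.2 * ⟪z.2, ξ.2⟫_ℝ)) ∧
      ∃ D : E3 × E3 →L[ℝ] E3 × E3, HasFDerivAt (twist o s) D z ∧
      ∀ ξ, D ξ = (dc ξ • z.1 + cosCoeff s z.2 • ξ.1 + dk ξ • cross o z.1 z.2
          + sinCoeff s z.2 • (cross o ξ.1 z.2 + cross o z.1 ξ.2),
        dc ξ • z.2 + cosCoeff s z.2 • ξ.2) := by
  have h0 : ‖z.2‖ ≠ 0 := by simpa using hv
  have hn : ContDiffAt ℝ 1 (fun z : E3 × E3 => ‖z.2‖) z := contDiffAt_snd.norm ℝ hv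
  have hc' : ContDiffAt ℝ 1 (fun z : E3 × E3 => cosCoeff s z.2) z :=
    (((hn.pow 2).sub contDiffAt_const).sqrt (by linarith)).div hn h0
  have hk' : ContDiffAt ℝ 1 (fun z : E3 × E3 => sinCoeff s z.2) z :=
    contDiffAt_const.div (hn.pow 2) (pow_ne_zero 2 h0)
  have hc := (hc'.differentiableAt (by simp)).hasFDerivAt
  have hk := (hk'.differentiableAt (by simp)).hasFDerivAt
  have hρ : HasFDerivAt (fun z : E3 × E3 => ‖z.2‖ ^ 2) _ z :=
    (hasStrictFDerivAt_norm_sq z.2).hasFDerivAt.comp z hasFDerivAt_snd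
  have hcr : HasFDerivAt (fun z : E3 × E3 => cross o z.1 z.2) _ z :=
    (cross o).hasFDerivAt_of_bilinear (hasFDerivAt_fst (p := z)) (hasFDerivAt_snd (p := z))
  have hopen : ∀ᶠ y : E3 × E3 in nhds z, y.2 ≠ 0 ∧ s ^ 2 < ‖y.2‖ ^ 2 :=
    ((isOpen_ne_fun continuous_snd continuous_const).inter
      (isOpen_lt continuous_const (continuous_snd.norm.pow 2))).mem_nhds ⟨hv, hs⟩
  set dc := fderiv ℝ (fun z : E3 × E3 => cosCoeff s z.2) z with hdc
  set dk := fderiv ℝ (fun z : E3 × E3 => sinCoeff s z.2) z with hdk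
  refine ⟨dc, dk, fun ξ => ?_, fun ξ => ?_, _,
    ((hc.smul hasFDerivAt_fst).add (hk.smul hcr)).prodMk (hc.smul hasFDerivAt_snd), fun ξ => ?_⟩
  · have h1 := ((hc.pow 2).mul hρ).congr_of_eventuallyEq
      (f₁ := fun z : E3 × E3 => ‖z.2‖ ^ 2 - s ^ 2) (by
        filter_upwards [hopen] with y hy using (cosCoeff_sq_mul hy.1 hy.2.le).symm)
    have h2 := congrArg (fun L => L ξ) (h1.unique (hρ.sub_const (s ^ 2)))
    have h3 := cosCoeff_sq_add hv hs.le
    simp at h2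
    refine mul_left_cancel₀ (pow_ne_zero 2 h0) ?_
    linear_combination h2 / 2 - ⟪z.2, ξ.2⟫_ℝ * h3
  · have h1 := (hk.mul hρ).congr_of_eventuallyEq
      (f₁ := fun z : E3 × E3 => s) (by
        filter_upwards [hopen] with y hy using (sinCoeff_mul hy.1).symm)
    have h2 := congrArg (fun L => L ξ) (h1.unique (hasFDerivAt_const s z))
    simp at h2
    rw [real_inner_self_eq_norm_sq]
    linear_combination h2
  · refine Prod.ext ?_ ?_
    · simp
      module
    · simp
      module

/-- Differentiate `emb ∘ twistCot = twist ∘ emb`, which holds on a neighbourhood of x because the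
condition is open. -/
theorem dEmb_mfderiv_twistCot {s : ℝ} {x : CotangentS2} (hx : covec x ≠ 0)
    (hs : s ^ 2 < ‖covec x‖ ^ 2) {D : E3 × E3 →L[ℝ] E3 × E3} (hD : HasFDerivAt (twist o s) D (emb x))
    (ξ : TangentSpace ICot x) :
    dEmb (twistCot o s x) (mfderiv ICot ICot (twistCot o s) x ξ) = D (dEmb x ξ) := by
  have h1 := (hasMFDerivAt_emb (twistCot o s x)).comp x
    ((contMDiffAt_twistCot o hx hs).mdifferentiableAt (by simp)).hasMFDerivAt
  have h2 := hD.hasMFDerivAt.comp x (hasMFDerivAt_emb x)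
  have hopen : ∀ᶠ y : CotangentS2 in nhds x, covec y ≠ 0 ∧ s ^ 2 < ‖covec y‖ ^ 2 :=
    ((isOpen_ne_fun contMDiff_covec.continuous continuous_const).inter
      (isOpen_lt continuous_const (contMDiff_covec.continuous.norm.pow 2))).mem_nhds ⟨hx, hs⟩
  have h3 := h2.congr_of_eventuallyEq (f₁ := emb ∘ twistCot o s) (by
    filter_upwards [hopen] with y hy using emb_twistCot hy.1 hy.2.le)
  exact congrArg (fun L => L ξ) (hasMFDerivAt_unique h1 h3)

set_option maxHeartbeats 1000000 in
theorem pullback_twistedForm {s : ℝ} {x : CotangentS2} (hx : covec x ≠ 0)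
    (hs : s ^ 2 < ‖covec x‖ ^ 2) :
    DiffForm.pullback (I := ICot) (twistCot o s) (twistedForm o s) x = liouville.d x := by
  obtain ⟨dc, dk, hdc, hdk, D, hD, hDξ⟩ := exists_fderiv_twist o (z := emb x) hx hs
  have hd := dEmb_mfderiv_twistCot o hx hs hD
  have hDξ' (ξ : E3 × E3) : D ξ = (dc ξ • (x.1 : E3) + cosCoeff s (covec x) • ξ.1
        + dk ξ • cross o x.1 (covec x)
        + sinCoeff s (covec x) • (cross o ξ.1 (covec x) + cross o x.1 ξ.2),
      dc ξ • covec x + cosCoeff s (covec x) • ξ.2) := hDξ ξ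
  ext v
  have h1 : DiffForm.pullback (I := ICot) (twistCot o s) (twistedForm o s) x v
      = twistedForm o s (twistCot o s x) (fun i => mfderiv ICot ICot (twistCot o s) x (v i)) := rfl
  have hfst : ((twistCot o s x).1 : E3) = cosCoeff s (covec x) • (x.1 : E3)
      + sinCoeff s (covec x) • cross o x.1 (covec x) :=
    congrArg Prod.fst (emb_twistCot hx hs.le)
  rw [h1, twistedForm_apply, liouville_d_apply, hd, hd, hDξ', hDξ', hfst]
  have hρ := real_inner_self_eq_norm_sq (covec x)
  refine twist_identity o (inner_self_S2 x.1) (inner_coe_covec x) ?_ ?_ ?_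
    (inner_dEmb_fst x _) (inner_dEmb_add x _) (inner_dEmb_fst x _) (inner_dEmb_add x _)
    (hdc _) (hdk _) (hdc _) (hdk _)
  · simpa using hx
  · rw [hρ]; exact cosCoeff_sq_add hx hs.le
  · rw [hρ]; exact sinCoeff_mul hx

/-! ### Symplectomorphism, equivariance and boundary behaviour -/

theorem isSymplectomorphismOn_twistCot {s : ℝ} (hs : 0 ≤ s) :
    IsSymplectomorphismOn liouville.d (twistedForm o s)
      {x : CotangentS2 | s < conorm x} {x : CotangentS2 | 0 < conorm x} (twistCot o s) := by
  have h1 {x : CotangentS2} (hx : 0 < conorm x) : covec x ≠ 0 := by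
    rw [conorm_eq] at hx; simpa using hx
  have h2 {x : CotangentS2} (hx : s < conorm x) : covec x ≠ 0 ∧ s ^ 2 < ‖covec x‖ ^ 2 := by
    refine ⟨h1 (hs.trans_lt hx), ?_⟩
    rw [conorm_eq] at hx
    gcongr
  have hinv : Set.InvOn (untwistCot o s) (twistCot o s) {x : CotangentS2 | s < conorm x}
      {x : CotangentS2 | 0 < conorm x} := by
    refine ⟨fun x hx => ?_, fun x hx => ?_⟩
    · rw [untwistCot, emb_twistCot (h2 hx).1 (h2 hx).2.le]
      exact (congrArg retr (untwist_twist (inner_coe_covec x) (h2 hx).1 (h2 hx).2)).trans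
        (retr_emb x)
    · rw [twistCot, emb_untwistCot s (h1 hx)]
      exact (congrArg retr (twist_untwist (inner_coe_covec x) (h1 hx))).trans (retr_emb x)
  refine ⟨isOpen_lt continuous_const continuous_conorm,
    isOpen_lt continuous_const continuous_conorm,
    fun x hx => (contMDiffAt_twistCot o (h2 hx).1 (h2 hx).2).contMDiffWithinAt,
    hinv.bijOn (fun x hx => ?_) (fun x hx => ?_), ⟨untwistCot o s, hinv, fun x hx =>
      (contMDiffAt_untwistCot o s (h1 hx)).contMDiffWithinAt⟩,
    fun x hx => pullback_twistedForm o (h2 hx).1 (h2 hx).2⟩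
  · rw [Set.mem_ofPred_eq, conorm_twistCot (h2 hx).1 (h2 hx).2.le, conorm_eq]
    exact Real.sqrt_pos.2 (by linarith [(h2 hx).2])
  · rw [Set.mem_ofPred_eq, conorm_untwistCot s (h1 hx)]
    refine Real.lt_sqrt_of_sq_lt ?_
    have : 0 < conorm x := hx
    nlinarith

theorem twistCot_cotangentLift {F : S2 ≃ₘ⟮𝓡 2, 𝓡 2⟯ S2} (hF : IsOrientedIsometry o F) {s : ℝ}
    {x : CotangentS2} (hx : covec x ≠ 0) (hs : s ^ 2 ≤ ‖covec x‖ ^ 2) :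
    twistCot o s (cotangentLift F x) = cotangentLift F (twistCot o s x) := by
  obtain ⟨A, hA⟩ := hF.exists_linear
  have hAx := covec_cotangentLift hA x
  have hn : ‖covec (cotangentLift F x)‖ = ‖covec x‖ := by rw [hAx, A.norm_map]
  refine emb_injective ?_
  rw [emb_cotangentLift hA, emb_twistCot hx hs, emb_twistCot (by simpa [hAx] using hx) (by rwa [hn]),
    emb_cotangentLift hA]
  simp only [twist, cosCoeff, sinCoeff, A.norm_map, hF.cross_eq hA, map_add, map_smul]

theorem exists_unit_orthogonal (q : S2) : ∃ u : E3, ‖u‖ = 1 ∧ ⟪(q : E3), u⟫_ℝ = 0 := by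
  have : Fact (Module.finrank ℝ E3 = 2 + 1) := ⟨finrank_euclideanSpace_fin⟩
  let b := OrthonormalBasis.fromOrthogonalSpanSingleton (𝕜 := ℝ) 2 (coe_S2_ne_zero q)
  exact ⟨b 0, b.orthonormal.1 0, Submodule.mem_orthogonal_singleton_iff_inner_right.1 (b 0).2⟩

theorem image_twistCot {s : ℝ} (hs : 0 < s) :
    twistCot o s '' {x : CotangentS2 | conorm x = s} = {x : CotangentS2 | conorm x = 0} := by
  have h2 {x : CotangentS2} (hx : conorm x = s) : covec x ≠ 0 ∧ s ^ 2 ≤ ‖covec x‖ ^ 2 := by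
    rw [conorm_eq] at hx
    refine ⟨fun h => ?_, by rw [hx]⟩
    rw [h, norm_zero] at hx
    exact hs.ne hx
  refine Set.Subset.antisymm ?_ fun y hy => ?_
  · rintro _ ⟨x, hx, rfl⟩
    rw [Set.mem_ofPred_eq, conorm_twistCot (h2 hx).1 (h2 hx).2, hx, sub_self, Real.sqrt_zero]
  -- On |v| = s the map is (q, v) ↦ (q × v / s, 0). For a unit u orthogonal to the target y, the
  -- pair q = u × y, v = s u works, since (u × y) × u = y.
  · obtain ⟨u, hu, hqu⟩ := exists_unit_orthogonal y.1
    have hy0 : covec y = 0 := by rwa [Set.mem_ofPred_eq, conorm_eq, norm_eq_zero] at hy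
    have huu : ⟪u, u⟫_ℝ = 1 := by rw [real_inner_self_eq_norm_sq, hu]; norm_num
    have huq : ⟪u, (y.1 : E3)⟫_ℝ = 0 := by rw [real_inner_comm, hqu]
    have hn : ‖cross o u y.1‖ = 1 := by
      refine (sq_eq_sq₀ (norm_nonneg _) zero_le_one).1 ?_
      rw [← real_inner_self_eq_norm_sq, inner_cross_cross, huu, inner_self_S2, huq]
      norm_num
    have he : emb (retr (cross o u y.1, s • u)) = (cross o u y.1, s • u) := by
      refine emb_retr hn ?_
      rw [real_inner_smul_right, real_inner_comm, inner_cross_left, mul_zero]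
    have hsu : ‖s • u‖ = s := by rw [norm_smul, hu, mul_one, Real.norm_eq_abs, abs_of_pos hs]
    refine ⟨retr (cross o u y.1, s • u), ?_, ?_⟩
    · rw [Set.mem_ofPred_eq, conorm_eq]
      exact (congrArg (fun z : E3 × E3 => ‖z.2‖) he).trans hsu
    · rw [twistCot, he]
      refine (congrArg retr ?_).trans (retr_emb y)
      simp only [twist, cosCoeff, sinCoeff, hsu, sub_self, Real.sqrt_zero, zero_div, zero_smul,
        zero_add, emb, hy0]
      rw [map_smul, cross_swap, cross_cross, huu, huq, smul_smul]
      refine Prod.ext ?_ rfl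
      have : s / s ^ 2 * s = 1 := by field_simp
      simp [this]

theorem twistCot_zero {x : CotangentS2} (hx : covec x ≠ 0) : twistCot o 0 x = x := by
  have h0 : ‖covec x‖ ≠ 0 := by simpa using hx
  have h : twist o 0 (emb x) = emb x := by
    simp [twist, emb, cosCoeff, sinCoeff, h0, Real.sqrt_sq]
  rw [twistCot, h, retr_emb]

end MagneticSphere

end

open MagneticSphere in
theorem proposition1p4 (o : Orientation ℝ E3 (Fin 3)) :
    ∃ Ψ : ℝ → CotangentS2 → CotangentS2,
      (∀ s : ℝ, 0 ≤ s →
        IsSymplectomorphismOn liouville.d (twistedForm o s)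
          {x : CotangentS2 | s < conorm x} {x : CotangentS2 | 0 < conorm x} (Ψ s)) ∧
      ContMDiffOn (𝓘(ℝ, ℝ).prod ICot) ICot ∞ (fun z : ℝ × CotangentS2 => Ψ z.1 z.2)
        {z : ℝ × CotangentS2 | 0 ≤ z.1 ∧ z.1 < conorm z.2} ∧
      (∀ s : ℝ, 0 ≤ s → ∀ F : S2 ≃ₘ⟮𝓡 2, 𝓡 2⟯ S2, IsOrientedIsometry o F →
        ∀ x : CotangentS2, s < conorm x →
          Ψ s (cotangentLift F x) = cotangentLift F (Ψ s x)) ∧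
      (∀ x : CotangentS2, 0 < conorm x → Ψ 0 x = x) ∧
      (∀ s : ℝ, 0 < s → ∃ Ψbar : CotangentS2 → CotangentS2,
        ContinuousOn Ψbar {x : CotangentS2 | s ≤ conorm x} ∧
        (∀ x : CotangentS2, s < conorm x → Ψbar x = Ψ s x) ∧
        Ψbar '' {x : CotangentS2 | conorm x = s} = {x : CotangentS2 | conorm x = 0}) := by
  have h1 {x : CotangentS2} (hx : 0 < conorm x) : covec x ≠ 0 := by
    rw [conorm_eq] at hx; simpa using hx
  have h2 {s : ℝ} {x : CotangentS2} (hs : 0 ≤ s) (hx : s < conorm x) :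
      s ^ 2 < ‖covec x‖ ^ 2 := by
    rw [conorm_eq] at hx
    gcongr
  refine ⟨twistCot o, fun s hs => isSymplectomorphismOn_twistCot o hs, fun z hz => ?_,
    fun s hs F hF x hx => ?_, fun x hx => twistCot_zero o (h1 hx), fun s hs => ?_⟩
  · exact (contMDiffAt_twistCot_uncurry o (h1 (hz.1.trans_lt hz.2))
      (h2 hz.1 hz.2)).contMDiffWithinAt
  · exact twistCot_cotangentLift o hF (h1 (hs.trans_lt hx)) (h2 hs hx).le
  -- The same formula serves as its own continuous extension.
  · refine ⟨twistCot o s, fun x hx => ContinuousAt.continuousWithinAt ?_, fun _ _ => rfl,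
      image_twistCot o hs⟩
    have hx' : s ≤ ‖covec x‖ := by rw [← conorm_eq]; exact hx
    exact continuousAt_twistCot o (h1 (hs.trans_le hx)) (by gcongr)
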